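/- **Theorem C.** Let $X$ be a (connected) complex projective manifold, with field of rational functions $\mathbb C(X)$, and let $\mathcal G$ be a singular holomorphic foliation of codimension $q\ge 2$ on $X$. (A foliation $\mathcal F$ is a pair of subsheaves $T_{\mathcal F}\subset T_X$, $N^*_{\mathcal F}\subset\Omega^1_X$, each the annihilator of the other, with $T_{\mathcal F}$ closed under Lie brackets; its codimension is the generic rank of $N^*_{\mathcal F}$; $\mathcal F$ contains $\mathcal G$ if $T_{\mathcal G}\subset T_{\mathcal F}$; the intersection of foliations is the foliation whose tangent sheaf is the intersection of their tangent sheaves.) Let $\mathbb C(X/\mathcal G)\subset\mathbb C(X)$ be the field of rational first integrals of $\mathcal G$, that is, of the rational functions annihilated by every local section of $T_{\mathcal G}$. Assume that $\operatorname{trdeg}_{\mathbb C}\mathbb C(X/\mathcal G)=0$ and that $\mathcal G$ is contained in $q+1$ codimension one foliations $\mathcal F_1,\dots,\mathcal F_{q+1}$ such that the intersection of any $q$ of them is equal to $\mathcal G$. Then at least one of the following holds. 1. There are rational $1$-forms $\omega_1,\dots,\omega_q$ on $X$ defining $\mathcal G$ (i.e. $T_{\mathcal G}$ is their common kernel in $T_X$)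 such that, for every $0\le r<q$, sending an $r$-plane $V\subset\mathbb C^q$ to the foliation with tangent sheaf $\{v\in T_X : \sum_i a_i\omega_i(v)=0 \text{ for all } a\in V\}$ is a well-defined bijection from the Grassmannian of $r$-planes in $\mathbb C^q$ onto the set of codimension $r$ foliations containing $\mathcal G$. Moreover, every foliation containing $\mathcal G$ is an intersection of finitely many transversely affine codimension one foliations (the empty intersection being the foliation with tangent sheaf $T_X$). Here a codimension one foliation is transversely affine if it is defined by a rational $1$-form $\alpha_0$ for which there is a closed rational $1$-form $\alpha_1$ with $d\alpha_0=\alpha_0\wedge\alpha_1$. 2. There are a non-abelian complex Lie algebra $\mathfrak g$ of dimension $q$ and a rational $1$-form $\Omega$ on $X$ with values in $\mathfrak g$ such that $d\Omega+\frac12[\Omega,\Omega]=0$ and $T_{\mathcal G}$ is the kernel of $\Omega$ in $T_X$ (that is, $\mathcal G$ is transversely Lie modeled over $\mathfrak g$). For every $0\le r<q$, sending a Lie subalgebra $\mathfrak h\subset\mathfrak g$ to the foliation whose tangent sheaf is the kernel of the composition of $\Omega$ with the projection $\mathfrak g\to\mathfrak g/\mathfrak h$ is a well-defined bijection from the set of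 Lie subalgebras of $\mathfrak g$ of codimension $r$ onto the set of codimension $r$ foliations containing $\mathcal G$. Moreover, every foliation $\mathcal F$ containing $\mathcal G$ is transversely homogeneous: there are a finite-dimensional complex Lie algebra $\mathfrak g'$, a rational $1$-form $\Omega'$ with values in $\mathfrak g'$ satisfying $d\Omega'+\frac12[\Omega',\Omega']=0$, and a Lie subalgebra $\mathfrak h'\subset\mathfrak g'$ with $\dim\mathfrak g'-\dim\mathfrak h'=\operatorname{codim}\mathcal F$ such that $T_{\mathcal F}$ is the kernel of the composition of $\Omega'$ with $\mathfrak g'\to\mathfrak g'/\mathfrak h'$. -/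

import Mathlib

open AlgebraicGeometry CategoryTheory TopologicalSpace
open scoped TensorProduct

noncomputable section

/-- The grading of `ℂ[x₀, …, x_N]` by degree. -/
abbrev polyGrading (N : ℕ) : ℕ → Submodule ℂ (MvPolynomial (Fin (N + 1)) ℂ) :=
  MvPolynomial.homogeneousSubmodule (Fin (N + 1)) ℂ

instance (N : ℕ) : GradedAlgebra (polyGrading N) := MvPolynomial.gradedAlgebra

/-- The complex projective space `ℙ^N`. -/
def complexProjectiveSpace (N : ℕ) : Scheme.{0} := Proj (polyGrading N)

/-- The structure morphism `ℙ^N ⟶ Spec ℂ`. -/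
def complexProjectiveSpace.structureMap (N : ℕ) :
    complexProjectiveSpace N ⟶ Spec (CommRingCat.of ℂ) :=
  Proj.toSpecZero (polyGrading N) ≫
    Spec.map (CommRingCat.ofHom (algebraMap ℂ (polyGrading N 0)))

/-- A (connected) complex projective manifold, that is an integral smooth scheme over `ℂ`
which is isomorphic to a closed subscheme of some `ℙ^N`. -/
structure ProjectiveManifold where
  scheme : Scheme.{0}
  structureMap : scheme ⟶ Spec (CommRingCat.of ℂ)
  isIntegral : IsIntegral scheme
  smooth : Smooth structureMap
  projective : ∃ (N : ℕ) (i : scheme ⟶ complexProjectiveSpace N),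
    IsClosedImmersion i ∧ i ≫ complexProjectiveSpace.structureMap N = structureMap

namespace ProjectiveManifold

attribute [instance] ProjectiveManifold.isIntegral

/-- The field `ℂ(X)` of rational functions of `X`. -/
def RationalFunction (X : ProjectiveManifold) : Type := X.scheme.functionField

instance (X : ProjectiveManifold) : Field X.RationalFunction :=
  inferInstanceAs (Field X.scheme.functionField)

/-- The inclusion of the constants in `ℂ(X)`: pull back a constant from `Spec ℂ` to a global
section of the structure sheaf of `X` and take the germ at the generic point. -/
def constants (X : ProjectiveManifold) : ℂ →+* X.RationalFunction :=
  (X.scheme.presheaf.germ ⊤ (genericPoint X.scheme) trivial).hom.comp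
    ((X.structureMap.appTop).hom.comp (Scheme.ΓSpecIso (CommRingCat.of ℂ)).inv.hom)

instance (X : ProjectiveManifold) : Algebra ℂ X.RationalFunction :=
  X.constants.toAlgebra

/-- The rational vector fields on `X`: the derivations of `ℂ(X)` over `ℂ`. -/
abbrev RationalVectorField (X : ProjectiveManifold) : Type :=
  Derivation ℂ X.RationalFunction X.RationalFunction

/-- The rational `1`-forms on `X`: the Kähler differentials of `ℂ(X)` over `ℂ`. -/
abbrev RationalForm (X : ProjectiveManifold) : Type :=
  Ω[X.RationalFunction⁄ℂ]

/-- The contraction `ω(v)` of a rational `1`-form with a rational vector field. -/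
def contract (X : ProjectiveManifold) (ω : X.RationalForm) (v : X.RationalVectorField) :
    X.RationalFunction :=
  v.liftKaehlerDifferential ω

/-- The value `dω(v, w)` of the exterior derivative of a rational `1`-form. -/
def extDeriv (X : ProjectiveManifold) (ω : X.RationalForm) (v w : X.RationalVectorField) :
    X.RationalFunction :=
  v (X.contract ω w) - w (X.contract ω v) - X.contract ω ⁅v, w⁆

/-- The local ring of `X` at a point `x`, as a subring of `ℂ(X)`. -/
def localRing (X : ProjectiveManifold) (x : X.scheme) : Subring X.RationalFunction :=
  (algebraMap (X.scheme.presheaf.stalk x) X.scheme.functionField).range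

/-- The non-empty Zariski open subsets of `X`. -/
abbrev NonemptyOpen (X : ProjectiveManifold) : Type :=
  {U : Opens X.scheme // (U : Set X.scheme).Nonempty}

/-- The ring `𝒪_X(U)`, as a subring of `ℂ(X)`. -/
def functions (X : ProjectiveManifold) (U : X.NonemptyOpen) : Subring X.RationalFunction :=
  ⨅ x ∈ U.1, X.localRing x

/-- The sections `T_X(U)` of the tangent sheaf, as a set of rational vector fields: those which
preserve the local ring of every point of `U`. -/
def vectorFields (X : ProjectiveManifold) (U : X.NonemptyOpen) : Set X.RationalVectorField :=
  {v | ∀ x ∈ U.1, ∀ f ∈ X.localRing x, v f ∈ X.localRing x}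

/-- The sections `Ω¹_X(U)` of the cotangent sheaf, as a set of rational `1`-forms: those which
at every `x ∈ U` are combinations `∑ fᵢ dgᵢ` with `fᵢ`, `gᵢ` in the local ring of `x`. -/
def forms (X : ProjectiveManifold) (U : X.NonemptyOpen) : Set X.RationalForm :=
  {ω | ∀ x ∈ U.1, ω ∈ Submodule.span (X.localRing x)
    (KaehlerDifferential.D ℂ X.RationalFunction '' (X.localRing x : Set X.RationalFunction))}

end ProjectiveManifold

/-- A singular holomorphic foliation on the projective manifold `X`: a pair `(T_F, N*_F)` of
subsheaves of `𝒪_X`-modules of `(T_X, Ω¹_X)`, each the annihilator of the other, with `T_F`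
involutive. Sections over a non-empty open set are seen as rational vector fields and rational
`1`-forms, so that the restriction maps are inclusions; compatibility with restriction and the
gluing property follow from the two annihilator conditions. -/
@[ext]
structure Foliation (X : ProjectiveManifold) where
  tangent : ∀ U : X.NonemptyOpen, Submodule (X.functions U) X.RationalVectorField
  conormal : ∀ U : X.NonemptyOpen, Submodule (X.functions U) X.RationalForm
  mem_tangent_iff : ∀ (U : X.NonemptyOpen) (v : X.RationalVectorField),
    v ∈ tangent U ↔ v ∈ X.vectorFields U ∧
      ∀ V : X.NonemptyOpen, V ≤ U → ∀ ω ∈ conormal V, X.contract ω v = 0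
  mem_conormal_iff : ∀ (U : X.NonemptyOpen) (ω : X.RationalForm),
    ω ∈ conormal U ↔ ω ∈ X.forms U ∧
      ∀ V : X.NonemptyOpen, V ≤ U → ∀ v ∈ tangent V, X.contract ω v = 0
  involutive : ∀ (U : X.NonemptyOpen), ∀ v ∈ tangent U, ∀ w ∈ tangent U, ⁅v, w⁆ ∈ tangent U

namespace Foliation

variable {X : ProjectiveManifold}

/-- The space of rational sections of the conormal sheaf of `F`. -/
def rationalConormal (F : Foliation X) : Submodule X.RationalFunction X.RationalForm :=
  Submodule.span X.RationalFunction (⋃ U, (F.conormal U : Set X.RationalForm))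

/-- The codimension of `F`: the generic rank of the conormal sheaf. -/
def codim (F : Foliation X) : ℕ :=
  Module.finrank X.RationalFunction F.rationalConormal

/-- The tangent sheaf of `F` consists of the vector fields which belong to `W`. -/
def DefinedBy (F : Foliation X) (W : Set X.RationalVectorField) : Prop :=
  ∀ (U : X.NonemptyOpen) (v : X.RationalVectorField),
    v ∈ F.tangent U ↔ v ∈ X.vectorFields U ∧ v ∈ W

/-- `G.ContainedIn F`: the tangent sheaf of `F` contains the tangent sheaf of `G`. -/
def ContainedIn (G F : Foliation X) : Prop :=
  ∀ (U : X.NonemptyOpen), ∀ v ∈ G.tangent U, v ∈ F.tangent U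

/-- `F` is the intersection of the foliations in `S`. -/
def IsIntersection (F : Foliation X) (S : Set (Foliation X)) : Prop :=
  ∀ (U : X.NonemptyOpen) (v : X.RationalVectorField),
    v ∈ F.tangent U ↔ v ∈ X.vectorFields U ∧ ∀ H ∈ S, v ∈ H.tangent U

/-- The field `ℂ(X/F)` of rational first integrals of `F`. -/
def firstIntegrals (F : Foliation X) : IntermediateField ℂ X.RationalFunction where
  carrier := {f | ∀ (U : X.NonemptyOpen), ∀ v ∈ F.tangent U, v f = 0}
  mul_mem' := by
    intro a b ha hb U v hv
    simp [ha U v hv, hb U v hv]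
  add_mem' := by
    intro a b ha hb U v hv
    simp [ha U v hv, hb U v hv]
  algebraMap_mem' := by
    intro c U v _
    simp
  inv_mem' := by
    intro a ha U v hv
    simp [Derivation.leibniz_inv, ha U v hv]

/-- A codimension one foliation is (singularly) transversely affine if it is defined by a rational
`1`-form `ω₀` for which there is a closed rational `1`-form `ω₁` with `dω₀ = ω₀ ∧ ω₁`. -/
def IsTransverselyAffine (F : Foliation X) : Prop :=
  F.codim = 1 ∧ ∃ ω₀ ω₁ : X.RationalForm,
    F.DefinedBy {v | X.contract ω₀ v = 0} ∧
    (∀ v w, X.extDeriv ω₁ v w = 0) ∧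
    ∀ v w, X.extDeriv ω₀ v w =
      X.contract ω₀ v * X.contract ω₁ w - X.contract ω₀ w * X.contract ω₁ v

end Foliation

section LieValuedForms

variable (X : ProjectiveManifold) (𝔤 : Type) [LieRing 𝔤] [LieAlgebra ℂ 𝔤]

/-- A rational `1`-form on `X` with values in `𝔤`, given by its contraction with rational vector
fields. -/
abbrev LieValuedForm : Type :=
  X.RationalVectorField →ₗ[X.RationalFunction] (X.RationalFunction ⊗[ℂ] 𝔤)

variable {X 𝔤}

/-- The derivative of a rational function with values in `𝔤` along a rational vector field. -/
def lieDerivative (v : X.RationalVectorField) :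
    (X.RationalFunction ⊗[ℂ] 𝔤) →ₗ[ℂ] (X.RationalFunction ⊗[ℂ] 𝔤) :=
  LinearMap.rTensor 𝔤 (v : X.RationalFunction →ₗ[ℂ] X.RationalFunction)

/-- The Maurer-Cartan equation `dΩ + ½[Ω, Ω] = 0`, evaluated on pairs of rational vector fields. -/
def MaurerCartan (Ω : LieValuedForm X 𝔤) : Prop :=
  ∀ v w : X.RationalVectorField,
    (lieDerivative v (Ω w) - lieDerivative w (Ω v) - Ω ⁅v, w⁆) + ⁅Ω v, Ω w⁆ = 0

/-- The kernel of the composition of contraction with `Ω` and the projection to `ℂ(X) ⊗ 𝔤/𝔥`. -/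
def kernelMod (Ω : LieValuedForm X 𝔤) (𝔥 : LieSubalgebra ℂ 𝔤) : Set X.RationalVectorField :=
  {v | LinearMap.lTensor X.RationalFunction 𝔥.toSubmodule.mkQ (Ω v) = 0}

/-- `Ω` is a rational transverse `𝔤`-structure for `F`. -/
def IsTransverseLieStructure (F : Foliation X) (Ω : LieValuedForm X 𝔤) : Prop :=
  Module.Finite ℂ 𝔤 ∧ Module.finrank ℂ 𝔤 = F.codim ∧ F.DefinedBy {v | Ω v = 0} ∧ MaurerCartan Ω

/-- `(Ω, 𝔥)` is a (singularly) transversely homogeneous structure for `F`. -/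
def IsTransverseHomogeneousStructure (F : Foliation X) (Ω : LieValuedForm X 𝔤)
    (𝔥 : LieSubalgebra ℂ 𝔤) : Prop :=
  Module.Finite ℂ 𝔤 ∧ MaurerCartan Ω ∧ Module.finrank ℂ 𝔥 + F.codim = Module.finrank ℂ 𝔤 ∧
    F.DefinedBy (kernelMod Ω 𝔥)

end LieValuedForms

/-- `F` is (singularly) transversely homogeneous. -/
def Foliation.IsTransverselyHomogeneous {X : ProjectiveManifold} (F : Foliation X) : Prop :=
  ∃ (𝔤 : Type) (_ : LieRing 𝔤) (_ : LieAlgebra ℂ 𝔤) (Ω : LieValuedForm X 𝔤)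
    (𝔥 : LieSubalgebra ℂ 𝔤), IsTransverseHomogeneousStructure F Ω 𝔥

/-- The set of foliations of codimension `r` containing `G`. -/
abbrev FoliationsContaining {X : ProjectiveManifold} (G : Foliation X) (r : ℕ) : Type :=
  {F : Foliation X // G.ContainedIn F ∧ F.codim = r}

/-- The Grassmannian of `r`-planes in `ℂ^q`. -/
abbrev GrassmannianOfPlanes (q r : ℕ) : Type :=
  {V : Submodule ℂ (Fin q → ℂ) // Module.finrank ℂ V = r}

/-- The variety of Lie subalgebras of `𝔤` of codimension `r`. -/
abbrev SubalgebrasOfCodim (𝔤 : Type) [LieRing 𝔤] [LieAlgebra ℂ 𝔤] (r : ℕ) : Type :=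
  {𝔥 : LieSubalgebra ℂ 𝔤 // Module.finrank ℂ 𝔥 + r = Module.finrank ℂ 𝔤}

/-- The foliations containing `G` are naturally identified with the linear subspaces of `ℂ^q`:
for suitable rational `1`-forms `ω₁, …, ω_q` defining `G`, the foliation corresponding to an
`r`-plane `V` is the one defined by the `1`-forms `∑ aᵢ ωᵢ` with `a ∈ V`. -/
def IdentifiedWithGrassmannians {X : ProjectiveManifold} (G : Foliation X) (q : ℕ) : Prop :=
  ∃ ω : Fin q → X.RationalForm,
    G.DefinedBy {v | ∀ i, X.contract (ω i) v = 0} ∧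
    ∀ r < q, ∃ e : GrassmannianOfPlanes q r ≃ FoliationsContaining G r,
      ∀ V, (e V).1.DefinedBy {v | ∀ a ∈ V.1, ∑ i, a i • X.contract (ω i) v = 0}

/-- The foliations containing `G` are naturally identified, through the transverse `𝔤`-structure
`Ω`, with the Lie subalgebras of `𝔤`: the foliation corresponding to `𝔥` is the kernel
of `Ω` modulo `𝔥`. -/
def IdentifiedWithSubalgebras {X : ProjectiveManifold} (G : Foliation X) (q : ℕ)
    {𝔤 : Type} [LieRing 𝔤] [LieAlgebra ℂ 𝔤] (Ω : LieValuedForm X 𝔤) : Prop :=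
  ∀ r < q, ∃ e : SubalgebrasOfCodim 𝔤 r ≃ FoliationsContaining G r,
    ∀ 𝔥, (e 𝔥).1.DefinedBy (kernelMod Ω 𝔥.1)

end

/-! ### Regularity of rational vector fields and forms on open subsets; finiteness of `ℂ(X)` -/

noncomputable section

namespace ProjectiveManifold

variable (X : ProjectiveManifold)

/-! Put K = ℂ(X). A foliation is the same thing as an involutive K-subspace of Der(K/ℂ), its space
of rational sections (`tangentSpace`, `ofSubspace`). So the theorem concerns an involutive subspace
T of codimension q and the involutive subspaces above it. By the hypothesis on first integrals, the
functions killed by T are the constants (`exists_constant`).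

The q+1 functionals defining the given foliations can be scaled so that one of them is the sum of
the others ω₁, …, ω_q (`exists_normalized_transverseFrame`). Let v be a frame dual to ω.
Integrability of each ωᵢ makes the Bott action of T on Der/T diagonal in this frame, and
integrability of the sum makes it scalar: [t, vⱼ] ≡ -η(t) vⱼ mod T for one η. This gives a dichotomy
(`exists_wedge_or_weight`). Either some f ≠ 0 satisfies t(f) = -η(t) f on T, and then the f⁻¹vᵢ
normalize T; or no such f exists, and this rigidity forces a single closed θ with dωᵢ = θ ∧ ωᵢ for
all i.

In the second case combinations of the ωᵢ with constant coefficients satisfy the same equation,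
hence are integrable, and even transversely affine. In the first case the derivations normalizing T,
modulo T, form a Lie algebra of dimension q over ℂ, and projection to it is a Maurer-Cartan form. If
this algebra is abelian, the rescaled ωᵢ are closed and the first alternative of the theorem holds
with θ = 0.

In both cases, that there are no further foliations is Galois-type descent: a subspace of K^q stable
under coordinatewise derivation by T is spanned by vectors with constant coordinates
(`mem_span_constants`). Applied to the annihilator of an involutive subspace it yields a plane in
ℂ^q (`exists_kernelOf_eq`); applied to its coordinates in a frame of symmetries it yields a Lie
subalgebra (`exists_kernelModulo_eq`). -/

theorem genericPoint_mem (U : X.NonemptyOpen) : genericPoint X.scheme ∈ U.1 :=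
  ((genericPoint_spec X.scheme).mem_open_set_iff U.1.isOpen).2 (by simpa using U.2)

/-- The intersection of two non-empty open subsets. -/
def inter (U V : X.NonemptyOpen) : X.NonemptyOpen :=
  ⟨U.1 ⊓ V.1, ⟨genericPoint X.scheme, X.genericPoint_mem U, X.genericPoint_mem V⟩⟩

theorem inter_le_left (U V : X.NonemptyOpen) : X.inter U V ≤ U := fun _ h => h.1

theorem inter_le_right (U V : X.NonemptyOpen) : X.inter U V ≤ V := fun _ h => h.2

theorem exists_open_mem_localRing (f : X.RationalFunction) :
    ∃ U : X.NonemptyOpen, ∀ x ∈ U.1, f ∈ X.localRing x := by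
  obtain ⟨U, hU, g, hg⟩ := X.scheme.presheaf.exists_germ_eq (x := genericPoint X.scheme) f
  refine ⟨⟨U, ⟨_, hU⟩⟩, fun x hx => ⟨X.scheme.presheaf.germ U x hx g, ?_⟩⟩
  have : Nonempty U := ⟨⟨x, hx⟩⟩
  rw [Scheme.algebraMap_germ_eq_germToFunctionField]
  exact hg

/-- On a suitable affine open subset, `ℂ(X)` is the fraction field of a finitely generated
algebra. -/
theorem exists_affine_generators : ∃ (U : X.NonemptyOpen) (S : Subalgebra ℂ X.RationalFunction),
    S.FG ∧ (∀ x ∈ U.1, ∀ f ∈ S, f ∈ X.localRing x) ∧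
    (∀ x ∈ U.1, ∀ f ∈ X.localRing x, ∃ a ∈ S, ∃ b ∈ S, b⁻¹ ∈ X.localRing x ∧ f = a / b) ∧
    ∀ f : X.RationalFunction, ∃ a ∈ S, ∃ b ∈ S, f = a / b := by
  obtain ⟨U, hU, hxU, -⟩ := exists_isAffineOpen_mem_and_subset
    (x := genericPoint X.scheme) (U := ⊤) trivial
  have hne : Nonempty U := ⟨⟨_, hxU⟩⟩
  have hsm := X.smooth
  have hft : (X.structureMap.appLE ⊤ U le_top).hom.FiniteType :=
    Scheme.Hom.finiteType_appLE _ (isAffineOpen_top _) hU _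
  let ψ : ℂ →+* Γ(X.scheme, U) := (X.structureMap.appLE ⊤ U le_top).hom.comp
    (Scheme.ΓSpecIso (CommRingCat.of ℂ)).inv.hom
  have hψ : ψ.FiniteType := by
    refine RingHom.FiniteType.comp hft (RingHom.FiniteType.of_surjective _ ?_)
    exact (ConcreteCategory.bijective_of_isIso (Scheme.ΓSpecIso (CommRingCat.of ℂ)).inv).2
  let _ : Algebra ℂ Γ(X.scheme, U) := ψ.toAlgebra
  have : Algebra.FiniteType ℂ Γ(X.scheme, U) := hψ
  let φ : Γ(X.scheme, U) →ₐ[ℂ] X.RationalFunction :=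
    { toRingHom := (X.scheme.germToFunctionField U).hom
      commutes' := fun c => by
        change (X.scheme.germToFunctionField U).hom ((X.structureMap.appLE ⊤ U le_top).hom _) =
          (X.scheme.presheaf.germ ⊤ (genericPoint X.scheme) trivial).hom
            ((X.structureMap.appTop).hom _)
        rw [← X.scheme.presheaf.germ_res (homOfLE (le_top : U ≤ ⊤)) _ hxU]
        rfl }
  refine ⟨⟨U, ⟨_, hxU⟩⟩, φ.range, ?_, ?_, ?_, ?_⟩
  · rw [← Algebra.map_top]
    exact Subalgebra.FG.map _ (Algebra.FiniteType.out)
  · rintro x hx _ ⟨g, rfl⟩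
    exact ⟨X.scheme.presheaf.germ U x hx g,
      Scheme.algebraMap_germ_eq_germToFunctionField X.scheme hx g⟩
  · rintro x hx _ ⟨s, rfl⟩
    let _ := X.scheme.presheaf.algebra_section_stalk ⟨x, hx⟩
    have hloc := hU.isLocalization_stalk ⟨x, hx⟩
    obtain ⟨⟨a, b⟩, hab⟩ := IsLocalization.surj (hU.primeIdealOf ⟨x, hx⟩).asIdeal.primeCompl s
    have hb := IsLocalization.map_units (X.scheme.presheaf.stalk x) b
    let σ : X.scheme.presheaf.stalk x →+* X.RationalFunction :=
      algebraMap (X.scheme.presheaf.stalk x) X.scheme.functionField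
    have hgerm : ∀ g : Γ(X.scheme, U),
        σ (algebraMap Γ(X.scheme, U) (X.scheme.presheaf.stalk x) g) = φ g :=
      fun g => Scheme.algebraMap_germ_eq_germToFunctionField X.scheme hx g
    have hb' : φ b ≠ 0 := by
      rw [← hgerm]
      exact (hb.map σ).ne_zero
    refine ⟨φ a, ⟨a, rfl⟩, φ b, ⟨b, rfl⟩, ?_, ?_⟩
    · obtain ⟨u, hu⟩ := hb
      refine ⟨(↑u⁻¹ : X.scheme.presheaf.stalk x), ?_⟩
      refine eq_inv_of_mul_eq_one_left ?_
      change σ _ * _ = _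
      rw [← hgerm, ← hu, ← map_mul, Units.inv_mul, map_one]
      rfl
    · change σ s = _
      rw [eq_div_iff hb', ← hgerm, ← hgerm, ← map_mul]
      exact congrArg σ hab
  · intro f
    have := functionField_isFractionRing_of_isAffineOpen X.scheme U hU
    obtain ⟨a, b, hb, rfl⟩ := IsFractionRing.div_surjective (A := Γ(X.scheme, U))
      (K := X.scheme.functionField) f
    exact ⟨φ a, ⟨a, rfl⟩, φ b, ⟨b, rfl⟩, rfl⟩

theorem exists_open_forall_mem_localRing {G : Type*} (s : Finset G) (h : G → X.RationalFunction) :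
    ∃ U : X.NonemptyOpen, ∀ g ∈ s, ∀ x ∈ U.1, h g ∈ X.localRing x := by
  classical
  induction s using Finset.induction_on with
  | empty => exact ⟨⟨⊤, ⟨genericPoint X.scheme, trivial⟩⟩, by simp⟩
  | insert g s _ ih =>
    obtain ⟨U, hU⟩ := ih
    obtain ⟨V, hV⟩ := X.exists_open_mem_localRing (h g)
    refine ⟨X.inter U V, fun g' hg' x hx => ?_⟩
    rcases Finset.mem_insert.1 hg' with rfl | hg'
    · exact hV x (X.inter_le_right U V hx)
    · exact hU g' hg' x (X.inter_le_left U V hx)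

/-- It is enough that the images of finitely many algebra generators are regular; the Leibniz and
quotient rules then reach every element of the local rings. -/
theorem exists_mem_vectorFields (v : X.RationalVectorField) :
    ∃ U : X.NonemptyOpen, v ∈ X.vectorFields U := by
  obtain ⟨U, S, ⟨G, hG⟩, hS, hloc, -⟩ := X.exists_affine_generators
  obtain ⟨V, hV⟩ := X.exists_open_forall_mem_localRing G v
  refine ⟨X.inter U V, fun x hx f hf => ?_⟩
  have hxU := X.inter_le_left U V hx
  have hvS : ∀ a ∈ S, v a ∈ X.localRing x := by
    intro a ha
    have hmem : ∀ a ∈ Algebra.adjoin ℂ (G : Set X.RationalFunction), a ∈ S := fun a ha => hG ▸ ha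
    rw [← hG] at ha
    induction ha using Algebra.adjoin_induction with
    | mem a ha => exact hV a ha x (X.inter_le_right U V hx)
    | algebraMap c => rw [Derivation.map_algebraMap]; exact Subring.zero_mem _
    | add a b _ _ ha hb => rw [map_add]; exact Subring.add_mem _ ha hb
    | mul a b ha' hb' ha hb =>
      rw [Derivation.leibniz, smul_eq_mul, smul_eq_mul]
      exact Subring.add_mem _ (Subring.mul_mem _ (hS x hxU a (hmem a ha')) hb)
        (Subring.mul_mem _ (hS x hxU b (hmem b hb')) ha)
  obtain ⟨a, ha, b, hb, hb', rfl⟩ := hloc x hxU f hf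
  rw [div_eq_mul_inv, Derivation.leibniz, Derivation.leibniz_inv, smul_eq_mul, smul_eq_mul,
    smul_eq_mul, neg_mul, pow_two]
  exact Subring.add_mem _ (Subring.mul_mem _ (hS x hxU a ha) (Subring.neg_mem _
    (Subring.mul_mem _ (Subring.mul_mem _ hb' hb') (hvS b hb)))) (Subring.mul_mem _ hb' (hvS a ha))

theorem vectorFields_anti {U V : X.NonemptyOpen} (h : V ≤ U) :
    X.vectorFields U ⊆ X.vectorFields V := fun _ hv x hx => hv x (h hx)

theorem forms_anti {U V : X.NonemptyOpen} (h : V ≤ U) : X.forms U ⊆ X.forms V :=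
  fun _ hω x hx => hω x (h hx)

theorem exists_mem_forms (ω : X.RationalForm) : ∃ U : X.NonemptyOpen, ω ∈ X.forms U := by
  have hω : ω ∈ Submodule.span X.RationalFunction
      (Set.range (KaehlerDifferential.D ℂ X.RationalFunction)) := by
    rw [KaehlerDifferential.span_range_derivation]
    trivial
  induction hω using Submodule.span_induction with
  | mem ω h =>
    obtain ⟨f, rfl⟩ := h
    obtain ⟨U, hU⟩ := X.exists_open_mem_localRing f
    exact ⟨U, fun x hx => Submodule.subset_span ⟨f, hU x hx, rfl⟩⟩
  | zero => exact ⟨⟨⊤, ⟨genericPoint X.scheme, trivial⟩⟩, fun x _ => Submodule.zero_mem _⟩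
  | add a b _ _ ha hb =>
    obtain ⟨U, hU⟩ := ha
    obtain ⟨V, hV⟩ := hb
    exact ⟨X.inter U V, fun x hx => Submodule.add_mem _ (hU x (X.inter_le_left U V hx))
      (hV x (X.inter_le_right U V hx))⟩
  | smul f ω _ hω =>
    obtain ⟨U, hU⟩ := X.exists_open_mem_localRing f
    obtain ⟨V, hV⟩ := hω
    exact ⟨X.inter U V, fun x hx => Submodule.smul_mem _
      (⟨f, hU x (X.inter_le_left U V hx)⟩ : X.localRing x) (hV x (X.inter_le_right U V hx))⟩

/-- This makes the rational forms, and hence the rational vector fields, finite-dimensional, so that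
the two are dual to each other. -/
instance : Algebra.EssFiniteType ℂ X.RationalFunction := by
  obtain ⟨U, S, ⟨G, hG⟩, -, -, hfrac⟩ := X.exists_affine_generators
  rw [← IntermediateField.fg_top_iff]
  refine ⟨G, ?_⟩
  rw [eq_top_iff]
  intro f _
  have hle : S ≤ (IntermediateField.adjoin ℂ (G : Set X.RationalFunction)).toSubalgebra := by
    rw [← hG]
    exact Algebra.adjoin_le (IntermediateField.subset_adjoin _ _)
  obtain ⟨a, ha, b, hb, rfl⟩ := hfrac f
  exact div_mem (hle ha) (hle hb)

instance : FiniteDimensional X.RationalFunction X.RationalVectorField :=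
  Module.Finite.equiv (KaehlerDifferential.linearMapEquivDerivation ℂ X.RationalFunction
    (M := X.RationalFunction))

/-- Rational `1`-forms are the linear functionals on rational vector fields. -/
def formEquiv : X.RationalForm ≃ₗ[X.RationalFunction]
    Module.Dual X.RationalFunction X.RationalVectorField :=
  (Module.evalEquiv X.RationalFunction X.RationalForm).trans
    (KaehlerDifferential.linearMapEquivDerivation ℂ X.RationalFunction
      (M := X.RationalFunction)).symm.dualMap

theorem formEquiv_apply (ω : X.RationalForm) (v : X.RationalVectorField) :
    X.formEquiv ω v = X.contract ω v := rfl

theorem contract_formEquiv_symm (φ : Module.Dual X.RationalFunction X.RationalVectorField)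
    (v : X.RationalVectorField) : X.contract (X.formEquiv.symm φ) v = φ v := by
  rw [← formEquiv_apply, LinearEquiv.apply_symm_apply]

end ProjectiveManifold
end

/-! ### Exterior calculus on derivations and the dichotomy -/

noncomputable section

namespace Derivation

variable {k K : Type*} [Field k] [Field K] [Algebra k K]

theorem lie_smul_right (v w : Derivation k K K) (f : K) : ⁅v, f • w⁆ = v f • w + f • ⁅v, w⁆ := by
  ext g
  simp [Derivation.commutator_apply]
  ring

theorem lie_smul_left (v w : Derivation k K K) (f : K) :
    ⁅f • v, w⁆ = f • ⁅v, w⁆ - w f • v := by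
  ext g
  simp [Derivation.commutator_apply]
  ring

/-- The exterior derivative of a linear functional on derivations. -/
def extD (ω : Module.Dual K (Derivation k K K)) :
    Derivation k K K →ₗ[K] Derivation k K K →ₗ[K] K :=
  LinearMap.mk₂ K (fun v w => v (ω w) - w (ω v) - ω ⁅v, w⁆)
    (by intros; simp; ring)
    (by intros; simp [lie_smul_left]; ring)
    (by intros; simp; ring)
    (by intros; simp; ring)

theorem extD_apply (ω : Module.Dual K (Derivation k K K)) (v w : Derivation k K K) :
    extD ω v w = v (ω w) - w (ω v) - ω ⁅v, w⁆ := rfl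

theorem extD_swap (ω : Module.Dual K (Derivation k K K)) (v w : Derivation k K K) :
    extD ω v w = - extD ω w v := by
  rw [extD_apply, extD_apply, ← lie_skew v w, map_neg]; ring

theorem extD_self (ω : Module.Dual K (Derivation k K K)) (v : Derivation k K K) :
    extD ω v v = 0 := by
  simp [extD_apply]

theorem extD_add (ω η : Module.Dual K (Derivation k K K)) (v w : Derivation k K K) :
    extD (ω + η) v w = extD ω v w + extD η v w := by
  simp [extD_apply]; ring

theorem extD_sub (ω η : Module.Dual K (Derivation k K K)) (v w : Derivation k K K) :
    extD (ω - η) v w = extD ω v w - extD η v w := by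
  simp [extD_apply]; ring

theorem extD_smul (f : K) (ω : Module.Dual K (Derivation k K K)) (v w : Derivation k K K) :
    extD (f • ω) v w = v f * ω w - w f * ω v + f * extD ω v w := by
  simp [extD_apply]; ring

/-- The differential of an element of `K`, as a functional on derivations. -/
def differential (f : K) : Module.Dual K (Derivation k K K) where
  toFun v := v f
  map_add' _ _ := rfl
  map_smul' _ _ := rfl

theorem extD_differential (f : K) (v w : Derivation k K K) : extD (differential f) v w = 0 := by
  simp [extD_apply, differential, Derivation.commutator_apply]

/-- This is d² = 0 in Cartan's form; it reduces to the Jacobi identity. -/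
theorem extD_extD (ω : Module.Dual K (Derivation k K K)) (a b c : Derivation k K K) :
    a (extD ω b c) + b (extD ω c a) + c (extD ω a b)
      - extD ω ⁅a, b⁆ c - extD ω ⁅b, c⁆ a - extD ω ⁅c, a⁆ b = 0 := by
  have hJ : ω ⁅⁅a, b⁆, c⁆ + ω ⁅⁅b, c⁆, a⁆ + ω ⁅⁅c, a⁆, b⁆ = 0 := by
    rw [← map_add, ← map_add]
    have := lie_jacobi a b c
    have h2 : ⁅⁅a, b⁆, c⁆ + ⁅⁅b, c⁆, a⁆ + ⁅⁅c, a⁆, b⁆ = 0 := by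
      have e1 := lie_skew c ⁅a, b⁆
      have e2 := lie_skew a ⁅b, c⁆
      have e3 := lie_skew b ⁅c, a⁆
      rw [← e1, ← e2, ← e3] at this
      rw [← neg_eq_zero, ← this]
      abel
    rw [h2, map_zero]
  have e1 : ω ⁅b, a⁆ = - ω ⁅a, b⁆ := by rw [← lie_skew, map_neg]
  have e2 : ω ⁅c, b⁆ = - ω ⁅b, c⁆ := by rw [← lie_skew, map_neg]
  have e3 : ω ⁅a, c⁆ = - ω ⁅c, a⁆ := by rw [← lie_skew, map_neg]
  simp only [extD_apply, map_sub, Derivation.commutator_apply]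
  linear_combination hJ

/-- `ExtDEqWedge η ω` says that `dω = η ∧ ω`. -/
def ExtDEqWedge (η ω : Module.Dual K (Derivation k K K)) : Prop :=
  ∀ v w, extD ω v w = η v * ω w - η w * ω v

/-- Differentiating dω = η ∧ ω gives dη ∧ ω = η ∧ dω = η ∧ η ∧ ω = 0. -/
theorem ExtDEqWedge.extD_wedge {η ω : Module.Dual K (Derivation k K K)} (h : ExtDEqWedge η ω)
    (a b c : Derivation k K K) :
    extD η a b * ω c + extD η b c * ω a + extD η c a * ω b = 0 := by
  have h0 := extD_extD ω a b c
  have hab := h a b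
  have hbc := h b c
  have hca := h c a
  simp only [h _ _, map_sub, Derivation.leibniz, smul_eq_mul] at h0
  simp only [extD_apply] at hab hbc hca ⊢
  linear_combination h0 + η c * hab + η a * hbc + η b * hca

/-- Frobenius: dω vanishes on pairs in ker ω, and projecting along v onto ker ω shows that η = dω(·,
v) works. -/
theorem exists_extDEqWedge {ω : Module.Dual K (Derivation k K K)} {v : Derivation k K K}
    (hv : ω v = 1) (hω : ∀ a b, ω a = 0 → ω b = 0 → ω ⁅a, b⁆ = 0) :
    ∃ η, ExtDEqWedge η ω := by
  refine ⟨(extD ω).flip v, fun a b => ?_⟩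
  have ha : ω (a - ω a • v) = 0 := by simp [hv]
  have hb : ω (b - ω b • v) = 0 := by simp [hv]
  have h := extD_apply ω (a - ω a • v) (b - ω b • v)
  rw [ha, hb, hω _ _ ha hb] at h
  simp only [map_sub, LinearMap.map_smul, LinearMap.sub_apply, LinearMap.smul_apply, extD_self, map_zero,
    smul_eq_mul] at h
  rw [extD_swap ω v b] at h
  simp only [LinearMap.flip_apply]
  linear_combination h

/-- If `T` acts on `x` modulo `T` with weight `c` and `β` kills `T`, then
`dβ(t, x) = t(β(x)) - c(t) β(x)`. -/
theorem extD_apply_of_kills {T : Submodule K (Derivation k K K)} {t x : Derivation k K K}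
    (ht : t ∈ T) {c : K} (hc : ⁅t, x⁆ - c • x ∈ T) {β : Module.Dual K (Derivation k K K)}
    (hβ : ∀ t ∈ T, β t = 0) : extD β t x = t (β x) - c * β x := by
  have h1 := hβ _ hc
  simp only [map_sub, LinearMap.map_smul, smul_eq_mul, sub_eq_zero] at h1
  rw [extD_apply, hβ t ht, h1]
  simp

/-- A frame `v` transverse to `T`, together with the dual coframe `ω`. -/
structure TransverseFrame {ι : Type*} [DecidableEq ι] (T : Submodule K (Derivation k K K))
    (ω : ι → Module.Dual K (Derivation k K K)) (v : ι → Derivation k K K) : Prop where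
  mem_iff : ∀ x, x ∈ T ↔ ∀ i, ω i x = 0
  dual : ∀ i j, ω i (v j) = if i = j then 1 else 0

namespace TransverseFrame

variable {ι : Type*} [DecidableEq ι] {T : Submodule K (Derivation k K K)}
  {ω : ι → Module.Dual K (Derivation k K K)} {v : ι → Derivation k K K}

theorem apply_self (h : TransverseFrame T ω v) (i : ι) : ω i (v i) = 1 := by simp [h.dual]

theorem apply_ne (h : TransverseFrame T ω v) {i j : ι} (hij : i ≠ j) : ω i (v j) = 0 := by
  simp [h.dual, hij]

theorem sub_sum_mem [Fintype ι] (h : TransverseFrame T ω v) (x : Derivation k K K) :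
    x - ∑ i, ω i x • v i ∈ T := by
  rw [h.mem_iff]
  intro i
  simp [h.dual]

theorem functional_ext [Fintype ι] (h : TransverseFrame T ω v)
    {M : Type*} [AddCommGroup M] [Module K M] {α β : Derivation k K K →ₗ[K] M}
    (hT : ∀ t ∈ T, α t = β t) (hv : ∀ i, α (v i) = β (v i)) : α = β := by
  ext1 x
  have := hT _ (h.sub_sum_mem x)
  simp only [map_sub, map_sum, LinearMap.map_smul, hv] at this
  simpa using this

theorem smul (h : TransverseFrame T ω v) {f : K} (hf : f ≠ 0) :
    TransverseFrame T (fun i => f • ω i) (fun i => f⁻¹ • v i) where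
  mem_iff x := by simp [h.mem_iff, hf]
  dual i j := by simp [h.dual, hf]

/-- Any nonzero function of the same weight under T as the frame can be used to rescale the frame
into T-invariance. When none exists, every obstruction to a common closed η must vanish, since each
would produce such a function. -/
theorem exists_wedge_or_weight [Fintype ι] [Nontrivial ι] [CharZero K]
    (h : TransverseFrame T ω v) (hinv : ∀ i, ∀ a b, ω i a = 0 → ω i b = 0 → ω i ⁅a, b⁆ = 0)
    (hsum : ∀ a b, ∑ i, ω i a = 0 → ∑ i, ω i b = 0 → ∑ i, ω i ⁅a, b⁆ = 0) :
    (∃ η, (∀ a b, extD η a b = 0) ∧ ∀ i, ExtDEqWedge η (ω i)) ∨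
      ∃ f : K, f ≠ 0 ∧ ∀ t ∈ T, ∀ i, ⁅t, f⁻¹ • v i⁆ ∈ T := by
  choose η hη using fun i => exists_extDEqWedge (h.apply_self i) (hinv i)
  have hωT : ∀ t ∈ T, ∀ i, ω i t = 0 := fun t ht => (h.mem_iff t).1 ht
  have hlie : ∀ t ∈ T, ∀ i, ω i ⁅t, v i⁆ = - η i t := by
    intro t ht i
    have := hη i t (v i)
    rw [extD_apply, hωT t ht, h.apply_self] at this
    simp at this
    linear_combination -this
  have hlie' : ∀ t ∈ T, ∀ i j, i ≠ j → ω i ⁅t, v j⁆ = 0 := fun t ht i j hij =>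
    hinv i _ _ (hωT t ht i) (h.apply_ne hij)
  have hsumv : ∀ t ∈ T, ∀ j, ∑ i, ω i ⁅t, v j⁆ = - η j t := by
    intro t ht j
    rw [Finset.sum_eq_single j (fun i _ hij => hlie' t ht i j hij) (by simp), hlie t ht]
  -- The difference `v i - v j` lies in the kernel of `∑ ω i`, so integrability of the sum compares
  -- the two weights.
  have hw : ∀ t ∈ T, ∀ i j, η i t = η j t := by
    intro t ht i j
    have := hsum t (v i - v j) (by simp [hωT t ht]) (by simp [h.dual])
    simp only [lie_sub, map_sub, Finset.sum_sub_distrib, hsumv t ht] at this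
    linear_combination -this
  obtain ⟨i₀⟩ : Nonempty ι := inferInstance
  have hlam : ∀ t ∈ T, ∀ j, ⁅t, v j⁆ - (- η i₀ t) • v j ∈ T := by
    intro t ht j
    rw [h.mem_iff]
    intro i
    by_cases hij : i = j
    · subst hij
      simp [hlie t ht, h.dual, hw t ht i i₀]
    · simp [hlie' t ht i j hij, h.dual, hij]
  have key : ∀ f : K, f ≠ 0 → (∀ t ∈ T, t f = - η i₀ t * f) →
      ∃ f : K, f ≠ 0 ∧ ∀ t ∈ T, ∀ i, ⁅t, f⁻¹ • v i⁆ ∈ T := by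
    intro f hf hft
    refine ⟨f, hf, fun t ht i => ?_⟩
    have : ⁅t, f⁻¹ • v i⁆ = f⁻¹ • (⁅t, v i⁆ - (- η i₀ t) • v i) := by
      rw [lie_smul_right, Derivation.leibniz_inv, hft t ht, smul_sub, smul_smul, sub_eq_add_neg,
        add_comm, ← neg_smul]
      congr 2
      simp only [smul_eq_mul]
      field_simp
    rw [this]
    exact T.smul_mem _ (hlam t ht i)
  -- The source of weight functions: if β kills T and dβ(T, `v j`) = 0, then β(`v j`) has the weight
  -- of the frame.
  have key' : ∀ β : Module.Dual K (Derivation k K K), (∀ t ∈ T, β t = 0) → ∀ j,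
      (∀ t ∈ T, extD β t (v j) = 0) → β (v j) ≠ 0 →
      ∃ f : K, f ≠ 0 ∧ ∀ t ∈ T, ∀ i, ⁅t, f⁻¹ • v i⁆ ∈ T := by
    intro β hβ j hj hne
    refine key _ hne fun t ht => ?_
    have := extD_apply_of_kills ht (hlam t ht j) hβ
    rw [hj t ht] at this
    linear_combination -this
  by_cases hcase : ∃ f : K, f ≠ 0 ∧ ∀ t ∈ T, ∀ i, ⁅t, f⁻¹ • v i⁆ ∈ T
  · exact Or.inr hcase
  left
  have hdη : ∀ i j, i ≠ j → ∀ t ∈ T, extD (η i) t (v j) = 0 := by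
    intro i j hij t ht
    have := (hη i).extD_wedge t (v j) (v i)
    rw [h.apply_self, h.apply_ne hij, hωT t ht] at this
    linear_combination this
  have hη_eq : ∀ i l j, i ≠ j → l ≠ j → η i (v j) = η l (v j) := by
    intro i l j hij hlj
    by_contra hne
    refine hcase (key' (η i - η l) (fun t ht => ?_) j (fun t ht => ?_) ?_)
    · simp [hw t ht i l]
    · rw [extD_sub, hdη i j hij t ht, hdη l j hlj t ht, sub_zero]
    · simpa [sub_eq_zero] using hne
  obtain ⟨i₁, hi₁⟩ := exists_ne i₀
  -- Each `η i` matters only modulo `ω i`, so its value on `v i` is free. By `hη_eq` the other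
  -- values agree; θ takes on `v i₀` the value prescribed by the other `η i`.
  set θ : Module.Dual K (Derivation k K K) := η i₀ + (η i₁ (v i₀) - η i₀ (v i₀)) • ω i₀ with hθ
  have hθv : ∀ i j, i ≠ j → θ (v j) = η i (v j) := by
    intro i j hij
    by_cases hj : j = i₀
    · subst hj
      simp [hθ, h.dual, hη_eq i₁ i j hi₁ hij]
    · simp [hθ, h.dual, Ne.symm hj, hη_eq i₀ i j (Ne.symm hj) hij]
  have hθω : ∀ i, θ = η i + (θ (v i) - η i (v i)) • ω i := by
    intro i
    refine h.functional_ext (fun t ht => ?_) (fun j => ?_)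
    · simp [hθ, hωT t ht, hw t ht i i₀]
    · by_cases hij : i = j
      · subst hij; simp [h.dual]
      · simp [h.dual, hij, hθv i j hij]
  have hwedge : ∀ i, ExtDEqWedge θ (ω i) := by
    intro i a b
    rw [hθω i, hη i]
    simp
    ring
  refine ⟨θ, ?_, hwedge⟩
  have hθT : ∀ t ∈ T, ∀ j, extD θ t (v j) = 0 := by
    intro t ht j
    obtain ⟨i, hij⟩ := exists_ne j
    have := (hwedge i).extD_wedge t (v j) (v i)
    rw [h.apply_self, h.apply_ne hij, hωT t ht] at this
    linear_combination this
  have hθTT : ∀ t ∈ T, ∀ s ∈ T, extD θ t s = 0 := by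
    intro t ht s hs
    have := (hwedge i₀).extD_wedge t s (v i₀)
    rw [h.apply_self, hωT s hs, hωT t ht] at this
    linear_combination this
  have hθT' : ∀ t ∈ T, extD θ t = 0 := fun t ht =>
    h.functional_ext (fun s hs => hθTT t ht s hs) (fun j => hθT t ht j)
  suffices hvv : ∀ i j, extD θ (v i) (v j) = 0 by
    have : extD θ = 0 := by
      refine h.functional_ext (fun t ht => hθT' t ht) fun i => ?_
      refine h.functional_ext (fun t ht => ?_) fun j => hvv i j
      rw [extD_swap, hθT' t ht]
      simp
    intro a b
    rw [this]
    rfl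
  intro i j
  by_contra hne
  set f := extD θ (v i) (v j) with hf
  -- Apply d² = 0 to θ at (t, `v i`, `v j`): each of the two frame vectors contributes the weight
  -- once.
  have htf : ∀ t ∈ T, t f = 2 * (- η i₀ t) * f := by
    intro t ht
    have h0 := extD_extD θ t (v i) (v j)
    have e1 : extD θ ⁅t, v i⁆ (v j) = (- η i₀ t) * f := by
      have := DFunLike.congr_fun (hθT' _ (hlam t ht i)) (v j)
      simp only [map_sub, LinearMap.map_smul, LinearMap.sub_apply, LinearMap.smul_apply, smul_eq_mul,
        LinearMap.zero_apply] at this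
      linear_combination this
    have e2 : extD θ ⁅v j, t⁆ (v i) = (- η i₀ t) * f := by
      have := DFunLike.congr_fun (hθT' _ (hlam t ht j)) (v i)
      simp only [map_sub, LinearMap.map_smul, LinearMap.sub_apply, LinearMap.smul_apply, smul_eq_mul,
        LinearMap.zero_apply] at this
      rw [← lie_skew, map_neg, LinearMap.neg_apply]
      rw [extD_swap θ (v j) (v i), ← hf] at this
      linear_combination -this
    rw [e1, e2, hθT t ht, extD_swap θ (v j) t, hθT t ht, extD_swap θ _ t, hθT' t ht, ← hf] at h0
    simp only [neg_zero, map_zero, LinearMap.zero_apply] at h0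
    linear_combination h0
  -- Half of the logarithmic derivative of f cancels θ on T without changing dθ. By `key'` the form
  -- β then vanishes on the frame too, so β = 0 and dθ = dβ = 0, contradicting f ≠ 0.
  set β : Module.Dual K (Derivation k K K) := θ + (2 * f)⁻¹ • differential f with hβ
  have hdβ : ∀ a b, extD β a b = extD θ a b := by
    intro a b
    rw [hβ, extD_add, extD_smul, extD_differential, Derivation.leibniz_inv, Derivation.leibniz_inv]
    have h2 : ∀ x : Derivation k K K, x (2 * f) = 2 * x f := by
      intro x
      rw [two_mul, map_add, two_mul]
    rw [h2, h2]
    simp only [differential, LinearMap.coe_mk, AddHom.coe_mk, smul_eq_mul]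
    ring
  have hβT : ∀ t ∈ T, β t = 0 := by
    intro t ht
    have hθt : θ t = η i₀ t := by simp [hθ, hωT t ht]
    simp only [hβ, LinearMap.add_apply, LinearMap.smul_apply, hθt, differential,
      LinearMap.coe_mk, AddHom.coe_mk, htf t ht, smul_eq_mul]
    field_simp
    ring
  have hβv : ∀ l, β (v l) = 0 := by
    intro l
    by_contra hl
    exact hcase (key' β hβT l (fun t ht => by rw [hdβ, hθT t ht]) hl)
  have hβ0 : β = 0 := h.functional_ext (fun t ht => hβT t ht) hβv
  apply hne
  rw [hf, ← hdβ, hβ0, extD_apply]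
  simp

end TransverseFrame

end Derivation

end

/-! ### Descent to constants and normalization of the coframe -/

noncomputable section

namespace Derivation

variable {k K : Type*} [Field k] [Field K] [Algebra k K]

/-- A subspace of `K^ι` stable under derivations whose only common constants are those of `k`
is spanned by its vectors with coordinates in `k`. -/
theorem mem_span_constants {ι : Type*} [Fintype ι] (S : Submodule K (ι → K))
    (Δ : Set (Derivation k K K))
    (hconst : ∀ f : K, (∀ d ∈ Δ, d f = 0) → ∃ c, algebraMap k K c = f)
    (hS : ∀ d ∈ Δ, ∀ s ∈ S, (fun i => d (s i)) ∈ S) {s : ι → K} (hs : s ∈ S) :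
    s ∈ Submodule.span K {x | x ∈ S ∧ ∃ a : ι → k, x = fun i => algebraMap k K (a i)} := by
  classical
  -- Induction on the size of the support. Once a coordinate is scaled to 1, a derivative kills it;
  -- subtracting a multiple of that derivative kills another coordinate of s, so s is a combination
  -- of two vectors of smaller support.
  obtain ⟨n, hn⟩ : ∃ n, (Finset.univ.filter fun i => s i ≠ 0).card = n := ⟨_, rfl⟩
  induction n using Nat.strong_induction_on generalizing s with
  | _ n ih =>
    by_cases h0 : s = 0
    · rw [h0]; exact Submodule.zero_mem _
    obtain ⟨i, hi⟩ := Function.ne_iff.1 h0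
    simp only [Pi.zero_apply] at hi
    set s₁ : ι → K := (s i)⁻¹ • s with hs₁
    have hs₁S : s₁ ∈ S := S.smul_mem _ hs
    have hss₁ : s = s i • s₁ := by rw [hs₁, smul_smul, mul_inv_cancel₀ hi, one_smul]
    by_cases hd : ∀ d ∈ Δ, ∀ j, d (s₁ j) = 0
    · rw [hss₁]
      refine Submodule.smul_mem _ _ (Submodule.subset_span ⟨hs₁S, ?_⟩)
      choose a ha using fun j => hconst (s₁ j) fun d hdΔ => hd d hdΔ j
      exact ⟨a, funext fun j => (ha j).symm⟩
    push Not at hd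
    obtain ⟨d, hdΔ, j, hj⟩ := hd
    set s' : ι → K := fun l => d (s₁ l) with hs'
    have hs'S : s' ∈ S := hS d hdΔ s₁ hs₁S
    have hs'i : s' i = 0 := by
      have h1 : s₁ i = 1 := inv_mul_cancel₀ hi
      rw [hs']
      simp only [h1, Derivation.map_one_eq_zero]
    have hsub : ∀ l, s l = 0 → s' l = 0 := by
      intro l hl
      simp [hs', hs₁, hl]
    have hsj : s j ≠ 0 := fun h => hj (hsub j h)
    have hlt : ∀ {x : ι → K} (l : ι), (∀ m, s m = 0 → x m = 0) → s l ≠ 0 → x l = 0 →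
        (Finset.univ.filter fun i => x i ≠ 0).card < n := by
      intro x l hx hsl hxl
      rw [← hn]
      refine Finset.card_lt_card ⟨fun m => ?_, fun h => ?_⟩
      · simp only [Finset.mem_filter, Finset.mem_univ, true_and]
        exact fun h1 h2 => h1 (hx m h2)
      · have := h (Finset.mem_filter.2 ⟨Finset.mem_univ l, hsl⟩)
        simp [hxl] at this
    have h1 := ih _ (hlt i hsub hi hs'i) hs'S rfl
    have h2S : s - (s j * (s' j)⁻¹) • s' ∈ S := S.sub_mem hs (S.smul_mem _ hs'S)
    have hj' : s' j ≠ 0 := hj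
    have h2 := ih _ (hlt (x := s - (s j * (s' j)⁻¹) • s') j (fun m hm => by
      simp [hm, hsub m hm]) hsj (by simp [hj'])) h2S rfl
    have : s = (s - (s j * (s' j)⁻¹) • s') + (s j * (s' j)⁻¹) • s' := by simp
    rw [this]
    exact Submodule.add_mem _ h2 (Submodule.smul_mem _ _ h1)

variable {T : Submodule K (Derivation k K K)}

theorem exists_transverseFrame [FiniteDimensional K (Derivation k K K)] {ι : Type*} [Fintype ι]
    [DecidableEq ι] {ω : ι → Module.Dual K (Derivation k K K)}
    (hT : ∀ x, x ∈ T ↔ ∀ i, ω i x = 0)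
    (hcodim : Module.finrank K T + Fintype.card ι = Module.finrank K (Derivation k K K)) :
    ∃ v, TransverseFrame T ω v := by
  have hker : LinearMap.ker (LinearMap.pi ω) = T := by
    ext x
    simp [hT, funext_iff]
  have hr := LinearMap.finrank_range_add_finrank_ker (LinearMap.pi ω)
  rw [hker] at hr
  have hsurj : LinearMap.range (LinearMap.pi ω) = ⊤ := by
    apply Submodule.eq_top_of_finrank_eq
    rw [Module.finrank_fintype_fun_eq_card]
    omega
  rw [LinearMap.range_eq_top] at hsurj
  choose v hv using fun j => hsurj (Pi.single j 1)
  refine ⟨v, hT, fun i j => ?_⟩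
  have := congrFun (hv j) i
  rw [LinearMap.pi_apply] at this
  rw [this, Pi.single_apply]

/-- General position gives `ω 0` nonzero coefficients in the coframe of the other functionals;
absorbing them makes `ω 0` the sum. -/
theorem exists_normalized_transverseFrame [FiniteDimensional K (Derivation k K K)] {q : ℕ}
    (hq : 0 < q)     {ω : Fin (q + 1) → Module.Dual K (Derivation k K K)}
    (hT : ∀ j x, x ∈ T ↔ ∀ i, i ≠ j → ω i x = 0)
    (hcodim : Module.finrank K T + q = Module.finrank K (Derivation k K K))
    (hinv : ∀ i, ∀ a b, ω i a = 0 → ω i b = 0 → ω i ⁅a, b⁆ = 0) :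
    ∃ (ω' : Fin q → Module.Dual K (Derivation k K K)) (v : Fin q → Derivation k K K),
      TransverseFrame T ω' v ∧ (∀ i, ∀ a b, ω' i a = 0 → ω' i b = 0 → ω' i ⁅a, b⁆ = 0) ∧
      ∀ a b, ∑ i, ω' i a = 0 → ∑ i, ω' i b = 0 → ∑ i, ω' i ⁅a, b⁆ = 0 := by
  have hT0 : ∀ x, x ∈ T ↔ ∀ i : Fin q, ω i.succ x = 0 := by
    intro x
    rw [hT 0]
    simp [Fin.forall_fin_succ]
  obtain ⟨v, hv⟩ := exists_transverseFrame hT0 (by simpa using hcodim)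
  have hc : ∀ i, ω 0 (v i) ≠ 0 := by
    intro i hi
    have : v i ∈ T := by
      rw [hT i.succ]
      intro j
      refine Fin.cases (fun _ => hi) (fun j hj => ?_) j
      exact hv.apply_ne (fun h => hj (congrArg _ h))
    have := (hT0 _).1 this i
    rw [hv.apply_self] at this
    exact one_ne_zero this
  have hω0 : ω 0 = ∑ i : Fin q, ω 0 (v i) • ω i.succ := by
    refine hv.functional_ext (fun t ht => ?_) fun j => ?_
    · simp only [LinearMap.sum_apply, LinearMap.smul_apply, (hT0 t).1 ht, smul_zero,
        Finset.sum_const_zero]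
      exact (hT (Fin.succ ⟨0, hq⟩) t).1 ht 0 (Fin.succ_ne_zero _).symm
    · simp [hv.dual]
  have hsum : ∀ x, ∑ i : Fin q, (ω 0 (v i) • ω i.succ) x = ω 0 x := by
    intro x
    conv_rhs => rw [hω0]
    rw [LinearMap.sum_apply]
  refine ⟨fun i => ω 0 (v i) • ω i.succ, fun i => (ω 0 (v i))⁻¹ • v i, ⟨fun x => ?_, ?_⟩,
    fun i a b ha hb => ?_, fun a b ha hb => ?_⟩
  · simp [hT0, hc]
  · intro i j
    by_cases hij : i = j
    · subst hij; simp [hv.dual, hc]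
    · simp [hv.dual, hij]
  · simp only [LinearMap.smul_apply, smul_eq_mul, mul_eq_zero, hc, false_or] at ha hb ⊢
    exact hinv _ a b ha hb
  · rw [hsum] at ha hb ⊢
    exact hinv _ a b ha hb

end Derivation
end

/-! ### The Lie algebra of transverse symmetries and its Maurer-Cartan form -/

noncomputable section

namespace Derivation

variable {k K : Type*} [Field k] [Field K] [Algebra k K]

/-- `T` is closed under Lie brackets. -/
def Involutive (T : Submodule K (Derivation k K K)) : Prop :=
  ∀ a ∈ T, ∀ b ∈ T, ⁅a, b⁆ ∈ T

/-- The Lie algebra of derivations which normalize `T`. -/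
def liftable (T : Submodule K (Derivation k K K)) : LieSubalgebra k (Derivation k K K) where
  carrier := {x | ∀ t ∈ T, ⁅t, x⁆ ∈ T}
  add_mem' ha hb t ht := by rw [lie_add]; exact T.add_mem (ha t ht) (hb t ht)
  zero_mem' t _ := by rw [lie_zero]; exact T.zero_mem
  smul_mem' c x hx t ht := by
    rw [lie_smul, ← algebraMap_smul K c]
    exact T.smul_mem _ (hx t ht)
  lie_mem' {x y} hx hy t ht := by
    change ⁅t, ⁅x, y⁆⁆ ∈ T
    rw [leibniz_lie, ← lie_skew x ⁅t, y⁆]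
    exact T.add_mem (hy _ (hx t ht)) (T.neg_mem (hx _ (hy t ht)))

/-- `T` as an ideal of the Lie algebra of derivations which normalize `T`. -/
def tangentIdeal (T : Submodule K (Derivation k K K)) : LieIdeal k (liftable T) where
  carrier := {x | (x : Derivation k K K) ∈ T}
  add_mem' ha hb := T.add_mem ha hb
  zero_mem' := T.zero_mem
  smul_mem' c x hx := by
    change c • (x : Derivation k K K) ∈ T
    rw [← algebraMap_smul K c]
    exact T.smul_mem _ hx
  lie_mem {x m} hm := by
    change ⁅(x : Derivation k K K), (m : Derivation k K K)⁆ ∈ T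
    rw [← lie_skew]
    exact T.neg_mem (x.2 _ hm)

/-- The Lie algebra of transverse symmetries of `T`. -/
abbrev TransverseAlgebra (T : Submodule K (Derivation k K K)) : Type _ :=
  liftable T ⧸ tangentIdeal T

/-- The class of a derivation normalizing `T`. -/
def toTransverse (T : Submodule K (Derivation k K K)) : liftable T →ₗ⁅k⁆ TransverseAlgebra T where
  toLinearMap := (LieSubmodule.Quotient.mk' (tangentIdeal T) : liftable T →ₗ[k] TransverseAlgebra T)
  map_lie' {x y} := LieSubmodule.Quotient.mk_bracket _ x y

theorem toTransverse_surjective (T : Submodule K (Derivation k K K)) :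
    Function.Surjective (toTransverse T) := LieSubmodule.Quotient.surjective_mk' _

theorem toTransverse_eq_zero {T : Submodule K (Derivation k K K)} {x : liftable T} :
    toTransverse T x = 0 ↔ (x : Derivation k K K) ∈ T :=
  LieSubmodule.Quotient.mk_eq_zero _

/-- The Leibniz rule for the derivative of an element of `K ⊗ E`. -/
theorem rTensor_smul (E : Type*) [AddCommGroup E] [Module k E] (d : Derivation k K K) (f : K)
    (y : K ⊗[k] E) :
    LinearMap.rTensor E (d : K →ₗ[k] K) (f • y) =
      d f • y + f • LinearMap.rTensor E (d : K →ₗ[k] K) y := by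
  induction y with
  | zero => simp
  | add a b ha hb => rw [smul_add, map_add, map_add, ha, hb]; simp only [smul_add]; abel
  | tmul g e =>
    simp only [TensorProduct.smul_tmul', smul_eq_mul, LinearMap.rTensor_tmul,
      ← TensorProduct.add_tmul]
    congr 1
    change d (f * g) = d f * g + f * d g
    rw [Derivation.leibniz]
    simp only [smul_eq_mul]
    ring

/-- The left hand side of the Maurer-Cartan equation. -/
def curvature {𝔤 : Type*} [LieRing 𝔤] [LieAlgebra k 𝔤]
    (Ω : Derivation k K K →ₗ[K] K ⊗[k] 𝔤) (a b : Derivation k K K) : K ⊗[k] 𝔤 :=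
  (LinearMap.rTensor 𝔤 (a : K →ₗ[k] K) (Ω b) - LinearMap.rTensor 𝔤 (b : K →ₗ[k] K) (Ω a)
    - Ω ⁅a, b⁆) + ⁅Ω a, Ω b⁆

theorem curvature_smul_right {𝔤 : Type*} [LieRing 𝔤] [LieAlgebra k 𝔤]
    (Ω : Derivation k K K →ₗ[K] K ⊗[k] 𝔤) (a b : Derivation k K K) (f : K) :
    curvature Ω a (f • b) = f • curvature Ω a b := by
  have h1 : LinearMap.rTensor 𝔤 ((f • b : Derivation k K K) : K →ₗ[k] K) (Ω a) =
      f • LinearMap.rTensor 𝔤 (b : K →ₗ[k] K) (Ω a) := by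
    induction Ω a with
    | zero => simp
    | add x y hx hy => simp only [map_add, hx, hy, smul_add]
    | tmul g e => simp [TensorProduct.smul_tmul']
  rw [curvature, curvature, h1, lie_smul_right, LinearMap.map_smul, rTensor_smul, map_add,
    LinearMap.map_smul, LinearMap.map_smul, lie_smul]
  simp only [smul_add, smul_sub]
  abel

theorem curvature_add_right {𝔤 : Type*} [LieRing 𝔤] [LieAlgebra k 𝔤]
    (Ω : Derivation k K K →ₗ[K] K ⊗[k] 𝔤) (a b c : Derivation k K K) :
    curvature Ω a (b + c) = curvature Ω a b + curvature Ω a c := by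
  have h1 : LinearMap.rTensor 𝔤 ((b + c : Derivation k K K) : K →ₗ[k] K) (Ω a) =
      LinearMap.rTensor 𝔤 (b : K →ₗ[k] K) (Ω a) + LinearMap.rTensor 𝔤 (c : K →ₗ[k] K) (Ω a) := by
    rw [← LinearMap.add_apply, ← LinearMap.rTensor_add]
    rfl
  rw [curvature, curvature, curvature, h1, map_add, lie_add, map_add, map_add, lie_add]
  abel

theorem curvature_swap {𝔤 : Type*} [LieRing 𝔤] [LieAlgebra k 𝔤]
    (Ω : Derivation k K K →ₗ[K] K ⊗[k] 𝔤) (a b : Derivation k K K) :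
    curvature Ω a b = - curvature Ω b a := by
  rw [curvature, curvature, ← lie_skew a b, map_neg, ← lie_skew (Ω a) (Ω b)]
  abel

/-- The curvature is tensorial and alternating in sign, so a spanning set suffices; it will be the
set of derivations normalizing T. -/
theorem curvature_eq_zero_of_span {𝔤 : Type*} [LieRing 𝔤] [LieAlgebra k 𝔤]
    {Ω : Derivation k K K →ₗ[K] K ⊗[k] 𝔤} {s : Set (Derivation k K K)}
    (hs : Submodule.span K s = ⊤) (h : ∀ a ∈ s, ∀ b ∈ s, curvature Ω a b = 0)
    (a b : Derivation k K K) : curvature Ω a b = 0 := by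
  have key : ∀ a, (∀ b ∈ s, curvature Ω a b = 0) → ∀ b, curvature Ω a b = 0 := by
    intro a ha b
    have hb : b ∈ Submodule.span K s := hs ▸ Submodule.mem_top
    induction hb using Submodule.span_induction with
    | mem b hb => exact ha b hb
    | zero => simpa using curvature_smul_right Ω a 0 0
    | add x y _ _ hx hy => rw [curvature_add_right, hx, hy, add_zero]
    | smul c x _ hx => rw [curvature_smul_right, hx, smul_zero]
  refine key a (fun b hb => ?_) b
  rw [curvature_swap, key b (fun c hc => h b hb c hc), neg_zero]

namespace TransverseFrame

variable {ι : Type*} [DecidableEq ι] [Fintype ι] {T : Submodule K (Derivation k K K)}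
  {ω : ι → Module.Dual K (Derivation k K K)} {v : ι → Derivation k K K}

/-- Both x and the frame commute with T modulo T, so T kills the coordinates of x, which are
therefore constants. -/
theorem apply_mem_range (h : TransverseFrame T ω v) (hv : ∀ i, v i ∈ liftable T)
    (hconst : ∀ f : K, (∀ d ∈ T, d f = 0) → ∃ c, algebraMap k K c = f)
    {x : Derivation k K K} (hx : x ∈ liftable T) (hT : Involutive T) (i : ι) :
    ∃ c, algebraMap k K c = ω i x := by
  refine hconst _ fun t ht => ?_
  have h1 : ⁅t, x - ∑ j, ω j x • v j⁆ ∈ T := hT t ht _ (h.sub_sum_mem x)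
  rw [lie_sub, lie_sum] at h1
  have h2 := (h.mem_iff _).1 ((T.sub_mem_iff_right (hx t ht)).1 h1) i
  have h3 : ∀ j, ω i ⁅t, v j⁆ = 0 := fun j => (h.mem_iff _).1 (hv j t ht) i
  simpa [lie_smul_right, h3, h.dual] using h2

theorem toTransverse_eq_sum (h : TransverseFrame T ω v) (hv : ∀ i, v i ∈ liftable T)
    {x : liftable T} {c : ι → k} (hc : ∀ i, algebraMap k K (c i) = ω i x) :
    toTransverse T x = ∑ i, c i • toTransverse T ⟨v i, hv i⟩ := by
  have : toTransverse T (x - ∑ i, c i • ⟨v i, hv i⟩) = 0 := by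
    rw [toTransverse_eq_zero]
    convert h.sub_sum_mem (x : Derivation k K K) using 1
    change (x : Derivation k K K) - _ = _
    rw [AddSubmonoidClass.coe_finsetSum]
    congr 1
    refine Finset.sum_congr rfl fun i _ => ?_
    rw [← hc, algebraMap_smul]
    rfl
  rw [map_sub, sub_eq_zero, map_sum] at this
  exact this

/-- The basis of the transverse algebra given by a frame of transverse symmetries. -/
def basis (h : TransverseFrame T ω v) (hv : ∀ i, v i ∈ liftable T)
    (hconst : ∀ f : K, (∀ d ∈ T, d f = 0) → ∃ c, algebraMap k K c = f) (hT : Involutive T) :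
    Module.Basis ι k (TransverseAlgebra T) :=
  .mk (v := fun i => toTransverse T ⟨v i, hv i⟩)
    (by
      rw [Fintype.linearIndependent_iff]
      intro c hc i
      have h1 : toTransverse T (∑ i, c i • ⟨v i, hv i⟩) = 0 := by
        rw [map_sum, ← hc]
        rfl
      rw [toTransverse_eq_zero] at h1
      have h2 := (h.mem_iff _).1 h1 i
      have h3 : ((∑ i, c i • (⟨v i, hv i⟩ : liftable T) : liftable T) : Derivation k K K)
          = ∑ i, algebraMap k K (c i) • v i := by
        rw [AddSubmonoidClass.coe_finsetSum]
        refine Finset.sum_congr rfl fun i _ => ?_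
        rw [algebraMap_smul]
        rfl
      rw [h3] at h2
      simpa [h.dual] using h2)
    (by
      rintro y -
      obtain ⟨x, rfl⟩ := toTransverse_surjective T y
      choose c hc using h.apply_mem_range hv hconst x.2 hT
      rw [h.toTransverse_eq_sum hv hc]
      exact Submodule.sum_mem _ fun i _ => Submodule.smul_mem _ _
        (Submodule.subset_span ⟨i, rfl⟩))

/-- The form with values in the transverse algebra which sends a transverse symmetry to its
class. -/
def form (_ : TransverseFrame T ω v) (hv : ∀ i, v i ∈ liftable T) :
    Derivation k K K →ₗ[K] K ⊗[k] TransverseAlgebra T :=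
  ∑ i, (ω i).smulRight ((1 : K) ⊗ₜ[k] toTransverse T ⟨v i, hv i⟩)

theorem form_apply (h : TransverseFrame T ω v) (hv : ∀ i, v i ∈ liftable T)
    (x : Derivation k K K) :
    h.form hv x = ∑ i, ω i x • ((1 : K) ⊗ₜ[k] toTransverse T ⟨v i, hv i⟩) := by
  simp [form]

variable (h : TransverseFrame T ω v) (hv : ∀ i, v i ∈ liftable T)
  (hconst : ∀ f : K, (∀ d ∈ T, d f = 0) → ∃ c, algebraMap k K c = f) (hT : Involutive T)

include hconst hT in
theorem form_apply_liftable (x : liftable T) :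
    h.form hv x = (1 : K) ⊗ₜ[k] toTransverse T x := by
  choose c hc using h.apply_mem_range hv hconst x.2 hT
  rw [h.toTransverse_eq_sum hv hc, form_apply, TensorProduct.tmul_sum]
  refine Finset.sum_congr rfl fun i _ => ?_
  rw [← hc, algebraMap_smul, TensorProduct.tmul_smul]

include hconst hT in
theorem form_eq_zero_iff (x : Derivation k K K) : h.form hv x = 0 ↔ x ∈ T := by
  rw [form_apply, h.mem_iff]
  have hb := (Algebra.TensorProduct.basis K (h.basis hv hconst hT)).linearIndependent
  rw [Fintype.linearIndependent_iff] at hb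
  refine ⟨fun hx i => hb (fun i => ω i x) ?_ i, fun hx => by simp [hx]⟩
  simpa [Algebra.TensorProduct.basis_apply, basis] using hx

include hconst hT in
theorem form_surjective : Function.Surjective (h.form hv) := by
  intro y
  induction y with
  | zero => exact ⟨0, map_zero _⟩
  | add a b ha hb =>
    obtain ⟨a, rfl⟩ := ha
    obtain ⟨b, rfl⟩ := hb
    exact ⟨a + b, map_add _ _ _⟩
  | tmul f g =>
    obtain ⟨x, rfl⟩ := toTransverse_surjective T g
    refine ⟨f • (x : Derivation k K K), ?_⟩
    rw [LinearMap.map_smul, h.form_apply_liftable hv hconst hT, TensorProduct.smul_tmul',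
      smul_eq_mul, mul_one]

include hconst hT in
theorem form_lie_liftable (a b : liftable T) :
    h.form hv ⁅(a : Derivation k K K), (b : Derivation k K K)⁆ =
      ⁅h.form hv (a : Derivation k K K), h.form hv (b : Derivation k K K)⁆ := by
  have := h.form_apply_liftable hv hconst hT ⁅a, b⁆
  rw [LieSubalgebra.coe_bracket] at this
  rw [this, h.form_apply_liftable hv hconst hT, h.form_apply_liftable hv hconst hT,
    LieHom.map_lie, LieAlgebra.ExtendScalars.bracket_tmul, mul_one]

include h hv hT in
theorem span_liftable : Submodule.span K (liftable T : Set (Derivation k K K)) = ⊤ := by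
  rw [eq_top_iff]
  intro x _
  have := h.sub_sum_mem x
  rw [← sub_add_cancel x (∑ i, ω i x • v i)]
  refine Submodule.add_mem _ (Submodule.subset_span fun t ht => hT t ht _ this) ?_
  exact Submodule.sum_mem _ fun i _ => Submodule.smul_mem _ _ (Submodule.subset_span (hv i))

include hconst hT in
theorem curvature_form (a b : Derivation k K K) : curvature (h.form hv) a b = 0 := by
  refine curvature_eq_zero_of_span (h.span_liftable hv hT) (fun a ha b hb => ?_) a b
  have h1 := h.form_apply_liftable hv hconst hT ⟨a, ha⟩
  have h2 := h.form_apply_liftable hv hconst hT ⟨b, hb⟩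
  have h3 := h.form_lie_liftable hv hconst hT ⟨a, ha⟩ ⟨b, hb⟩
  simp only at h1 h2 h3
  rw [curvature, h3, h1, h2]
  simp

end TransverseFrame

end Derivation
end

/-! ### Involutive subspaces above T: planes of constants and Lie subalgebras -/

noncomputable section

namespace Derivation

variable {k K : Type*} [Field k] [Field K] [Algebra k K]

theorem involutive_span {N : LieSubalgebra k (Derivation k K K)} :
    Involutive (Submodule.span K (N : Set (Derivation k K K))) := by
  have key : ∀ a ∈ N, ∀ b ∈ Submodule.span K (N : Set (Derivation k K K)),
      ⁅a, b⁆ ∈ Submodule.span K (N : Set (Derivation k K K)) := by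
    intro a ha b hb
    induction hb using Submodule.span_induction with
    | mem b hb => exact Submodule.subset_span (N.lie_mem ha hb)
    | zero => rw [lie_zero]; exact Submodule.zero_mem _
    | add x y _ _ hx hy => rw [lie_add]; exact Submodule.add_mem _ hx hy
    | smul c x hx' hx =>
      rw [lie_smul_right]
      exact Submodule.add_mem _ (Submodule.smul_mem _ _ hx') (Submodule.smul_mem _ _ hx)
  intro a ha b hb
  induction ha using Submodule.span_induction with
  | mem a ha => exact key a ha b hb
  | zero => rw [zero_lie]; exact Submodule.zero_mem _
  | add x y _ _ hx hy => rw [add_lie]; exact Submodule.add_mem _ hx hy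
  | smul c x hx' hx =>
    rw [lie_smul_left]
    exact Submodule.sub_mem _ (Submodule.smul_mem _ _ hx) (Submodule.smul_mem _ _ hx')

theorem ExtDEqWedge.sum_smul {ι : Type*} [Fintype ι]
    {η : Module.Dual K (Derivation k K K)} {ω : ι → Module.Dual K (Derivation k K K)}
    (h : ∀ i, ExtDEqWedge η (ω i)) (a : ι → k) : ExtDEqWedge η (∑ i, a i • ω i) := by
  intro x y
  have h1 : ∀ z, (∑ i, a i • ω i) z = ∑ i, a i • ω i z := by
    intro z
    rw [LinearMap.sum_apply]
    rfl
  rw [extD_apply, h1, h1, h1, map_sum, map_sum, Finset.mul_sum, Finset.mul_sum,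
    ← Finset.sum_sub_distrib, ← Finset.sum_sub_distrib, ← Finset.sum_sub_distrib]
  refine Finset.sum_congr rfl fun i _ => ?_
  have := h i x y
  rw [extD_apply] at this
  rw [Derivation.map_smul, Derivation.map_smul, ← smul_sub, ← smul_sub, this, smul_sub,
    mul_smul_comm, mul_smul_comm]

/-- The common kernel of the functionals `∑ aᵢ ωᵢ`, `a ∈ V`. -/
def kernelOf {ι : Type*} [Fintype ι] (ω : ι → Module.Dual K (Derivation k K K))
    (V : Submodule k (ι → k)) : Submodule K (Derivation k K K) where
  carrier := {x | ∀ a ∈ V, ∑ i, a i • ω i x = 0}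
  add_mem' {x y} hx hy a ha := by
    simp only [map_add, smul_add, Finset.sum_add_distrib, hx a ha, hy a ha, add_zero]
  zero_mem' a _ := by simp
  smul_mem' c x hx a ha := by
    have : ∑ i, a i • ω i (c • x) = c • ∑ i, a i • ω i x := by
      rw [Finset.smul_sum]
      refine Finset.sum_congr rfl fun i _ => ?_
      rw [LinearMap.map_smul, smul_comm]
    rw [this, hx a ha, smul_zero]

theorem mem_kernelOf {ι : Type*} [Fintype ι] {ω : ι → Module.Dual K (Derivation k K K)}
    {V : Submodule k (ι → k)} {x : Derivation k K K} :
    x ∈ kernelOf ω V ↔ ∀ a ∈ V, ∑ i, a i • ω i x = 0 := Iff.rfl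

theorem involutive_kernelOf {ι : Type*} [Fintype ι]
    {η : Module.Dual K (Derivation k K K)} {ω : ι → Module.Dual K (Derivation k K K)}
    (h : ∀ i, ExtDEqWedge η (ω i)) (V : Submodule k (ι → k)) : Involutive (kernelOf ω V) := by
  intro x hx y hy a ha
  have h1 : ∀ z, (∑ i, a i • ω i) z = ∑ i, a i • ω i z := by
    intro z
    rw [LinearMap.sum_apply]
    rfl
  have := ExtDEqWedge.sum_smul h a x y
  rw [extD_apply, h1, h1, h1, hx a ha, hy a ha] at this
  simpa using this

namespace TransverseFrame

variable {ι : Type*} [DecidableEq ι] [Fintype ι] {T : Submodule K (Derivation k K K)}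
  {ω : ι → Module.Dual K (Derivation k K K)} {v : ι → Derivation k K K}

theorem le_kernelOf (h : TransverseFrame T ω v) (V : Submodule k (ι → k)) :
    T ≤ kernelOf ω V := fun x hx a _ => by simp [(h.mem_iff x).1 hx]

theorem apply_sum_smul (h : TransverseFrame T ω v) (c : ι → K) (i : ι) :
    ω i (∑ j, c j • v j) = c i := by
  simp [h.dual]

theorem finrank_kernelOf [FiniteDimensional K (Derivation k K K)]
    (h : TransverseFrame T ω v) (V : Submodule k (ι → k)) :
    Module.finrank K (kernelOf ω V) + Module.finrank k V =
      Module.finrank K (Derivation k K K) := by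
  let φ : Derivation k K K →ₗ[K] (V →ₗ[k] K) :=
    { toFun := fun x =>
        { toFun := fun a => ∑ i, a.1 i • ω i x
          map_add' := fun a b => by
            simp [add_smul, Finset.sum_add_distrib]
          map_smul' := fun c a => by
            simp [Finset.smul_sum, mul_smul] }
      map_add' := fun x y => by
        ext a
        simp [Finset.sum_add_distrib]
      map_smul' := fun c x => by
        ext a
        simp [Finset.mul_sum] }
  have hker : LinearMap.ker φ = kernelOf ω V := by
    ext x
    rw [LinearMap.mem_ker, mem_kernelOf, LinearMap.ext_iff]
    exact ⟨fun hx a ha => hx ⟨a, ha⟩, fun hx a => hx a.1 a.2⟩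
  have hsurj : LinearMap.range φ = ⊤ := by
    rw [LinearMap.range_eq_top]
    intro f
    obtain ⟨g, hg⟩ := LinearMap.exists_extend f
    refine ⟨∑ j, g (Pi.single j 1) • v j, ?_⟩
    ext a
    change ∑ i, a.1 i • ω i _ = _
    simp only [h.apply_sum_smul]
    rw [← hg]
    simp only [LinearMap.comp_apply, Submodule.subtype_apply]
    conv_rhs => rw [pi_eq_sum_univ' a.1]
    rw [map_sum]
    refine Finset.sum_congr rfl fun i _ => ?_
    rw [_root_.map_smul]
  have := LinearMap.finrank_range_add_finrank_ker φ
  rw [hsurj, hker, finrank_top, Module.finrank_linearMap_self] at this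
  omega

/-- V is recovered from its kernel: a functional on `ι → k` vanishing on V but not at a gives,
through the dual frame, a derivation in the kernel that detects a. -/
theorem mem_iff_kills_kernelOf (h : TransverseFrame T ω v) {V : Submodule k (ι → k)}
    {a : ι → k} : a ∈ V ↔ ∀ x ∈ kernelOf ω V, ∑ i, a i • ω i x = 0 := by
  refine ⟨fun ha x hx => hx a ha, fun hx => ?_⟩
  by_contra ha
  obtain ⟨f, hf, hfV⟩ := Submodule.exists_le_ker_of_notMem ha
  have key : ∀ b : ι → k, ∑ i, b i • ω i (∑ j, algebraMap k K (f (Pi.single j 1)) • v j) =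
      algebraMap k K (f b) := by
    intro b
    simp only [h.apply_sum_smul]
    conv_rhs => rw [pi_eq_sum_univ' b]
    rw [map_sum, map_sum]
    refine Finset.sum_congr rfl fun i _ => ?_
    rw [_root_.map_smul, Algebra.smul_def, smul_eq_mul, map_mul]
  have h0 := hx (∑ j, algebraMap k K (f (Pi.single j 1)) • v j) fun b hb => by
    rw [key, LinearMap.mem_ker.1 (hfV hb), map_zero]
  rw [key] at h0
  exact hf ((algebraMap k K).injective (by rw [h0, map_zero]))

theorem exists_kernelOf_eq (h : TransverseFrame T ω v)
    (hconst : ∀ f : K, (∀ d ∈ T, d f = 0) → ∃ c, algebraMap k K c = f)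
    {η : Module.Dual K (Derivation k K K)} (hη : ∀ i, ExtDEqWedge η (ω i))
    {W : Submodule K (Derivation k K K)} (hTW : T ≤ W) (hW : Involutive W) :
    ∃ V : Submodule k (ι → k), kernelOf ω V = W := by
  let V : Submodule k (ι → k) :=
    { carrier := {a | ∀ x ∈ W, ∑ i, a i • ω i x = 0}
      add_mem' := fun {a b} ha hb x hx => by
        simp [add_smul, Finset.sum_add_distrib, ha x hx, hb x hx]
      zero_mem' := fun x _ => by simp
      smul_mem' := fun c a ha x hx => by
        have := ha x hx
        simp only [Pi.smul_apply, smul_eq_mul, mul_smul]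
        rw [← Finset.smul_sum, this, smul_zero] }
  refine ⟨V, le_antisymm (fun x hx => ?_) fun x hx a ha => ha x hx⟩
  by_contra hxW
  obtain ⟨g, hg, hgW⟩ := Submodule.exists_le_ker_of_notMem hxW
  have hgs : g = ∑ i, g (v i) • ω i := by
    refine h.functional_ext (fun t ht => ?_) fun j => ?_
    · simp [LinearMap.mem_ker.1 (hgW (hTW ht)), (h.mem_iff t).1 ht]
    · simp [h.dual]
  let S : Submodule K (ι → K) :=
    { carrier := {s | ∀ x ∈ W, ∑ i, s i * ω i x = 0}
      add_mem' := fun {a b} ha hb x hx => by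
        simp [add_mul, Finset.sum_add_distrib, ha x hx, hb x hx]
      zero_mem' := fun x _ => by simp
      smul_mem' := fun c a ha x hx => by
        simp [mul_assoc, ← Finset.mul_sum, ha x hx] }
  have hgS : (fun i => g (v i)) ∈ S := by
    intro x hx
    have := LinearMap.mem_ker.1 (hgW hx)
    rw [hgs] at this
    simpa using this
  -- Differentiate ∑ sᵢ ωᵢ(x) = 0 along t. Since t(ωᵢ(x)) = ωᵢ([t, x]) + η(t) ωᵢ(x) with η
  -- independent of i, and [t, x] ∈ W, only ∑ t(sᵢ) ωᵢ(x) survives.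
  have hstab : ∀ d ∈ (T : Set (Derivation k K K)), ∀ s ∈ S, (fun i => d (s i)) ∈ S := by
    intro t ht s hs x hx
    have h1 : ∀ i, t (ω i x) = ω i ⁅t, x⁆ + η t * ω i x := by
      intro i
      have := hη i t x
      rw [extD_apply, (h.mem_iff t).1 ht i] at this
      simp only [map_zero, sub_zero, mul_zero] at this
      linear_combination this
    have h2 : t (∑ i, s i * ω i x) = 0 := by rw [hs x hx, map_zero]
    rw [map_sum] at h2
    simp only [Derivation.leibniz, h1, smul_eq_mul, Finset.sum_add_distrib, mul_add] at h2
    rw [hs _ (hW _ (hTW ht) _ hx)] at h2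
    have h3 : ∑ i, s i * (η t * ω i x) = 0 := by
      have : ∑ i, s i * (η t * ω i x) = η t * ∑ i, s i * ω i x := by
        rw [Finset.mul_sum]
        exact Finset.sum_congr rfl fun i _ => by ring
      rw [this, hs x hx, mul_zero]
    rw [h3] at h2
    simp only [zero_add] at h2
    rw [← h2]
    exact Finset.sum_congr rfl fun i _ => mul_comm _ _
  have hle : Submodule.span K {s | s ∈ S ∧ ∃ a : ι → k, s = fun i => algebraMap k K (a i)} ≤
      LinearMap.ker (Fintype.linearCombination K fun i => ω i x) := by
    rw [Submodule.span_le]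
    rintro _ ⟨hsS, a, rfl⟩
    have ha : a ∈ V := fun y hy => by simpa [Algebra.smul_def] using hsS y hy
    simpa [Algebra.smul_def, Fintype.linearCombination_apply] using hx a ha
  have key := hle (mem_span_constants S (T : Set (Derivation k K K)) hconst hstab hgS)
  apply hg
  rw [hgs]
  simpa [Fintype.linearCombination_apply] using key

variable (h : TransverseFrame T ω v) (hv : ∀ i, v i ∈ liftable T)
  (hconst : ∀ f : K, (∀ d ∈ T, d f = 0) → ∃ c, algebraMap k K c = f) (hT : Involutive T)

/-- The kernel of the transverse form modulo a subalgebra. -/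
def kernelModulo (𝔥 : LieSubalgebra k (TransverseAlgebra T)) : Submodule K (Derivation k K K) :=
  LinearMap.ker ((LinearMap.baseChange K 𝔥.toSubmodule.mkQ).comp (h.form hv))

theorem mem_kernelModulo {𝔥 : LieSubalgebra k (TransverseAlgebra T)} {x : Derivation k K K} :
    x ∈ h.kernelModulo hv 𝔥 ↔
      LinearMap.lTensor K 𝔥.toSubmodule.mkQ (h.form hv x) = 0 := by
  rw [← LinearMap.baseChange_eq_ltensor]
  rfl

include hconst hT in
theorem le_kernelModulo (𝔥 : LieSubalgebra k (TransverseAlgebra T)) :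
    T ≤ h.kernelModulo hv 𝔥 := by
  intro x hx
  rw [mem_kernelModulo, (h.form_eq_zero_iff hv hconst hT x).2 hx, map_zero]

include hconst hT in
theorem liftable_mem_kernelModulo {𝔥 : LieSubalgebra k (TransverseAlgebra T)} (x : liftable T) :
    (x : Derivation k K K) ∈ h.kernelModulo hv 𝔥 ↔ toTransverse T x ∈ 𝔥 := by
  rw [mem_kernelModulo, h.form_apply_liftable hv hconst hT, LinearMap.lTensor_tmul,
    ← TensorProduct.tmul_zero (R := k) _ (1 : K)]
  have hinj := Module.FaithfullyFlat.tensorProduct_mk_injective (A := k) (B := K)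
    (TransverseAlgebra T ⧸ 𝔥.toSubmodule)
  refine ⟨fun hx => ?_, fun hx => ?_⟩
  · exact (Submodule.Quotient.mk_eq_zero _).1 (hinj hx)
  · congr 1
    exact (Submodule.Quotient.mk_eq_zero _).2 hx

/-- The derivations normalizing `T` whose class lies in `𝔥`. -/
def liftOf (𝔥 : LieSubalgebra k (TransverseAlgebra T)) : LieSubalgebra k (Derivation k K K) :=
  (𝔥.comap (toTransverse T)).map (liftable T).incl

theorem mem_liftOf {𝔥 : LieSubalgebra k (TransverseAlgebra T)} {x : Derivation k K K} :
    x ∈ liftOf 𝔥 ↔ ∃ y : liftable T, toTransverse T y ∈ 𝔥 ∧ (y : Derivation k K K) = x := by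
  rw [liftOf, LieSubalgebra.mem_map]
  rfl

include hconst hT in
-- Exactness of K ⊗ - places the value of the form in K ⊗ 𝔥, where it lifts to a combination of
-- symmetries; the discrepancy lies in T. Involutivity then follows from `involutive_span`.
theorem kernelModulo_eq_span (𝔥 : LieSubalgebra k (TransverseAlgebra T)) :
    h.kernelModulo hv 𝔥 = Submodule.span K (liftOf 𝔥 : Set (Derivation k K K)) := by
  apply le_antisymm
  · intro x hx
    rw [mem_kernelModulo] at hx
    have hex := lTensor_exact K (f := 𝔥.toSubmodule.subtype) (g := 𝔥.toSubmodule.mkQ)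
      (LinearMap.exact_subtype_mkQ _) (Submodule.mkQ_surjective _)
    obtain ⟨z, hz⟩ := (hex _).1 hx
    have key : ∀ z : K ⊗[k] 𝔥.toSubmodule, ∃ y ∈ Submodule.span K (liftOf 𝔥 : Set _),
        h.form hv y = LinearMap.lTensor K 𝔥.toSubmodule.subtype z := by
      intro z
      induction z with
      | zero => exact ⟨0, Submodule.zero_mem _, by simp⟩
      | add a b ha hb =>
        obtain ⟨a', ha, ha'⟩ := ha
        obtain ⟨b', hb, hb'⟩ := hb
        exact ⟨a' + b', Submodule.add_mem _ ha hb, by rw [map_add, map_add, ha', hb']⟩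
      | tmul f g =>
        obtain ⟨y, hy⟩ := toTransverse_surjective T g.1
        refine ⟨f • (y : Derivation k K K), Submodule.smul_mem _ _ (Submodule.subset_span
          (mem_liftOf.2 ⟨y, ?_, rfl⟩)), ?_⟩
        · rw [hy]; exact g.2
        · rw [LinearMap.map_smul, h.form_apply_liftable hv hconst hT, hy,
            TensorProduct.smul_tmul', smul_eq_mul, mul_one]
          rfl
    obtain ⟨y, hy, hy'⟩ := key z
    have hxy : x - y ∈ T := by
      rw [← h.form_eq_zero_iff hv hconst hT, map_sub, hy', hz, sub_self]
    rw [← sub_add_cancel x y]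
    refine Submodule.add_mem _ (Submodule.subset_span (mem_liftOf.2
      ⟨⟨x - y, fun t ht => hT t ht _ hxy⟩, ?_, rfl⟩)) hy
    rw [toTransverse_eq_zero.2 hxy]
    exact 𝔥.zero_mem
  · rw [Submodule.span_le]
    rintro _ hx
    obtain ⟨y, hy, rfl⟩ := mem_liftOf.1 hx
    exact (h.liftable_mem_kernelModulo hv hconst hT y).2 hy

include hconst hT in
theorem involutive_kernelModulo (𝔥 : LieSubalgebra k (TransverseAlgebra T)) :
    Involutive (h.kernelModulo hv 𝔥) := by
  rw [h.kernelModulo_eq_span hv hconst hT]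
  exact involutive_span

include hconst hT in
theorem kernelModulo_injective : Function.Injective (h.kernelModulo hv) := by
  intro 𝔥 𝔥' he
  ext y
  obtain ⟨x, rfl⟩ := toTransverse_surjective T y
  rw [← h.liftable_mem_kernelModulo hv hconst hT, ← h.liftable_mem_kernelModulo hv hconst hT, he]

include h hv hconst hT in
theorem finrank_transverseAlgebra :
    Module.finrank k (TransverseAlgebra T) = Fintype.card ι :=
  Module.finrank_eq_card_basis (h.basis hv hconst hT)

include h hv hconst hT in
theorem finite_transverseAlgebra : Module.Finite k (TransverseAlgebra T) :=
  Module.Finite.of_basis (h.basis hv hconst hT)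

include hconst hT in
theorem finrank_kernelModulo [FiniteDimensional K (Derivation k K K)]
    (𝔥 : LieSubalgebra k (TransverseAlgebra T)) :
    Module.finrank K (h.kernelModulo hv 𝔥) + Module.finrank k (TransverseAlgebra T) =
      Module.finrank K (Derivation k K K) + Module.finrank k 𝔥 := by
  have := h.finite_transverseAlgebra hv hconst hT
  have h1 := LinearMap.finrank_range_add_finrank_ker
    ((LinearMap.baseChange K 𝔥.toSubmodule.mkQ).comp (h.form hv))
  have hsurj : LinearMap.range ((LinearMap.baseChange K 𝔥.toSubmodule.mkQ).comp (h.form hv))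
      = ⊤ := by
    rw [LinearMap.range_eq_top, LinearMap.coe_comp]
    refine Function.Surjective.comp ?_ (h.form_surjective hv hconst hT)
    rw [LinearMap.baseChange_eq_ltensor]
    exact LinearMap.lTensor_surjective _ (Submodule.mkQ_surjective _)
  rw [hsurj, finrank_top, Module.finrank_baseChange] at h1
  have h2 := 𝔥.toSubmodule.finrank_quotient_add_finrank
  change _ + Module.finrank k 𝔥 = _ at h2
  change _ + Module.finrank K (h.kernelModulo hv 𝔥) = _ at h1
  omega

include hconst hT in
theorem exists_kernelModulo_eq {W : Submodule K (Derivation k K K)} (hTW : T ≤ W)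
    (hW : Involutive W) : ∃ 𝔥, h.kernelModulo hv 𝔥 = W := by
  let W' : LieSubalgebra k (liftable T) :=
    { carrier := {x | (x : Derivation k K K) ∈ W}
      add_mem' := fun ha hb => W.add_mem ha hb
      zero_mem' := W.zero_mem
      smul_mem' := fun c x hx => by
        change c • (x : Derivation k K K) ∈ W
        rw [← algebraMap_smul K c]
        exact W.smul_mem _ hx
      lie_mem' := fun {x y} hx hy => hW _ hx _ hy }
  refine ⟨W'.map (toTransverse T), le_antisymm ?_ ?_⟩
  · rw [h.kernelModulo_eq_span hv hconst hT, Submodule.span_le]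
    intro x hx
    obtain ⟨y, hy, rfl⟩ := mem_liftOf.1 hx
    obtain ⟨z, hz, hzy⟩ := (LieSubalgebra.mem_map _ _ _).1 hy
    have : toTransverse T (y - z) = 0 := by rw [map_sub, sub_eq_zero]; exact hzy.symm
    rw [toTransverse_eq_zero] at this
    have h1 := W.add_mem (hTW this) hz
    have h2 : ((y - z : liftable T) : Derivation k K K) + z = y := sub_add_cancel _ _
    rwa [h2] at h1
  · intro w hw
    let φ : (ι → K) →ₗ[K] Derivation k K K := Fintype.linearCombination K v
    have hφ : ∀ s, φ s = ∑ i, s i • v i := fun s => Fintype.linearCombination_apply ..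
    -- In [t, ∑ sᵢ vᵢ] the terms sᵢ [t, vᵢ] lie in T ≤ W, leaving ∑ t(sᵢ) vᵢ in W.
    have hstab : ∀ d ∈ (T : Set (Derivation k K K)), ∀ s ∈ W.comap φ,
        (fun i => d (s i)) ∈ W.comap φ := by
      intro t ht s hs
      rw [Submodule.mem_comap, hφ] at hs ⊢
      have h1 := hW t (hTW ht) _ hs
      rw [lie_sum] at h1
      simp only [lie_smul_right, Finset.sum_add_distrib] at h1
      exact (W.add_mem_iff_left (W.sum_mem fun i _ => W.smul_mem _ (hTW (hv i t ht)))).1 h1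
    have hsum := h.sub_sum_mem w
    have hs : (fun i => ω i w) ∈ W.comap φ := by
      rw [Submodule.mem_comap, hφ]
      exact (W.sub_mem_iff_right hw).1 (hTW hsum)
    have key := mem_span_constants (W.comap φ) (T : Set (Derivation k K K)) hconst hstab hs
    rw [← sub_add_cancel w (∑ i, ω i w • v i)]
    refine Submodule.add_mem _ (h.le_kernelModulo hv hconst hT _ hsum) ?_
    rw [← hφ (fun i => ω i w), ← Submodule.mem_comap]
    refine (Submodule.span_le.2 ?_) key
    rintro _ ⟨hs, a, rfl⟩
    have hl : φ (fun i => algebraMap k K (a i)) ∈ liftable T := by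
      rw [hφ]
      refine (liftable T).toSubmodule.sum_mem fun i _ => ?_
      rw [algebraMap_smul]
      exact (liftable T).toSubmodule.smul_mem _ (hv i)
    refine (h.liftable_mem_kernelModulo hv hconst hT ⟨_, hl⟩).2
      ((LieSubalgebra.mem_map _ _ _).2 ⟨⟨_, hl⟩, hs, rfl⟩)

include h hv hT in
-- All brackets among T and the frame fall in T and `ω i` is constant on the frame, so `ω i` is
-- closed.
theorem extDEqWedge_zero_of_isLieAbelian (hab : IsLieAbelian (TransverseAlgebra T)) (i : ι) :
    ExtDEqWedge 0 (ω i) := by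
  have hvv : ∀ i j, ⁅v i, v j⁆ ∈ T := by
    intro i j
    have : toTransverse T ⁅(⟨v i, hv i⟩ : liftable T), ⟨v j, hv j⟩⁆ = 0 := by
      rw [LieHom.map_lie, hab.trivial]
    exact toTransverse_eq_zero.1 this
  have hωT : ∀ t ∈ T, ∀ i, ω i t = 0 := fun t ht => (h.mem_iff t).1 ht
  have hd : ∀ j l, v j (ω i (v l)) = 0 := by
    intro j l
    by_cases hil : i = l <;> simp [h.dual, hil]
  have hzero : extD (ω i) = 0 := by
    refine h.functional_ext (fun t ht => ?_) fun j => ?_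
    · refine h.functional_ext (fun s hs => ?_) fun j => ?_
      · simp [extD_apply, hωT t ht, hωT s hs, hωT _ (hT t ht s hs)]
      · rw [extD_apply, hωT t ht, hωT _ (hv j t ht)]
        by_cases hij : i = j <;> simp [h.dual, hij]
    · refine h.functional_ext (fun s hs => ?_) fun l => ?_
      · rw [extD_swap, extD_apply, hωT s hs, hωT _ (hv j s hs)]
        by_cases hij : i = j <;> simp [h.dual, hij]
      · rw [extD_apply, hd, hd, hωT _ (hvv j l)]
        simp
  intro a b
  simp [hzero]

end TransverseFrame

/-- Either the transverse structure is projectively flat, or it is Lie modeled. -/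
theorem exists_wedge_or_liftable [CharZero K] [FiniteDimensional K (Derivation k K K)] {q : ℕ}
    (hq : 2 ≤ q) {T : Submodule K (Derivation k K K)}
    {ω : Fin (q + 1) → Module.Dual K (Derivation k K K)}
    (hT : ∀ j x, x ∈ T ↔ ∀ i, i ≠ j → ω i x = 0)
    (hcodim : Module.finrank K T + q = Module.finrank K (Derivation k K K))
    (hinv : ∀ i, ∀ a b, ω i a = 0 → ω i b = 0 → ω i ⁅a, b⁆ = 0) :
    ∃ (ω' : Fin q → Module.Dual K (Derivation k K K)) (v : Fin q → Derivation k K K),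
      TransverseFrame T ω' v ∧
      ((∃ η, (∀ a b, extD η a b = 0) ∧ ∀ i, ExtDEqWedge η (ω' i)) ∨ ∀ i, v i ∈ liftable T) := by
  have : Nontrivial (Fin q) := Fin.nontrivial_iff_two_le.2 hq
  obtain ⟨ω', v, h, h1, h2⟩ := exists_normalized_transverseFrame (by omega) hT hcodim hinv
  obtain h3 | ⟨f, hf, h3⟩ := h.exists_wedge_or_weight h1 h2
  · exact ⟨ω', v, h, Or.inl h3⟩
  · exact ⟨_, _, h.smul hf, Or.inr fun i t ht => h3 t ht i⟩

end Derivation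
end

/-! ### Foliations as involutive subspaces of rational vector fields -/

noncomputable section

namespace ProjectiveManifold

variable (X : ProjectiveManifold)

theorem mem_functions {U : X.NonemptyOpen} {f : X.RationalFunction} :
    f ∈ X.functions U ↔ ∀ x ∈ U.1, f ∈ X.localRing x := by
  simp [functions, Subring.mem_iInf]

theorem contract_add (ω η : X.RationalForm) (v : X.RationalVectorField) :
    X.contract (ω + η) v = X.contract ω v + X.contract η v := map_add _ _ _

theorem contract_smul (f : X.RationalFunction) (ω : X.RationalForm) (v : X.RationalVectorField) :
    X.contract (f • ω) v = f * X.contract ω v := LinearMap.map_smul _ _ _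

theorem contract_zero (v : X.RationalVectorField) : X.contract 0 v = 0 := map_zero _

theorem contract_apply_add (ω : X.RationalForm) (v w : X.RationalVectorField) :
    X.contract ω (v + w) = X.contract ω v + X.contract ω w := by
  simp [← formEquiv_apply]

theorem contract_apply_smul (ω : X.RationalForm) (f : X.RationalFunction)
    (v : X.RationalVectorField) : X.contract ω (f • v) = f * X.contract ω v := by
  simp [← formEquiv_apply]

theorem exists_contract_ne_zero {W : Submodule X.RationalFunction X.RationalVectorField}
    {v : X.RationalVectorField} (hv : v ∉ W) :
    ∃ ω : X.RationalForm, X.contract ω v ≠ 0 ∧ ∀ w ∈ W, X.contract ω w = 0 := by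
  obtain ⟨g, hg, hgW⟩ := Submodule.exists_le_ker_of_notMem hv
  refine ⟨X.formEquiv.symm g, by rwa [contract_formEquiv_symm], fun w hw => ?_⟩
  rw [contract_formEquiv_symm]
  exact hgW hw

theorem lie_mem_vectorFields {U : X.NonemptyOpen} {v w : X.RationalVectorField}
    (hv : v ∈ X.vectorFields U) (hw : w ∈ X.vectorFields U) : ⁅v, w⁆ ∈ X.vectorFields U := by
  intro x hx f hf
  rw [Derivation.commutator_apply]
  exact Subring.sub_mem _ (hv x hx _ (hw x hx f hf)) (hw x hx _ (hv x hx f hf))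

end ProjectiveManifold

namespace Foliation

variable {X : ProjectiveManifold}

theorem conormal_anti (F : Foliation X) {U V : X.NonemptyOpen} (h : V ≤ U) {ω : X.RationalForm}
    (hω : ω ∈ F.conormal U) : ω ∈ F.conormal V := by
  rw [F.mem_conormal_iff] at hω ⊢
  exact ⟨X.forms_anti h hω.1, fun V' hV' v hv => hω.2 V' (hV'.trans h) v hv⟩

/-- The space of rational sections of the tangent sheaf. -/
def tangentSpace (F : Foliation X) : Submodule X.RationalFunction X.RationalVectorField where
  carrier := {v | ∀ U, ∀ ω ∈ F.conormal U, X.contract ω v = 0}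
  add_mem' hv hw U ω hω := by rw [X.contract_apply_add, hv U ω hω, hw U ω hω, add_zero]
  zero_mem' U ω _ := by rw [← X.formEquiv_apply, map_zero]
  smul_mem' f v hv U ω hω := by rw [X.contract_apply_smul, hv U ω hω, mul_zero]

theorem mem_tangent (F : Foliation X) {U : X.NonemptyOpen} {v : X.RationalVectorField} :
    v ∈ F.tangent U ↔ v ∈ X.vectorFields U ∧ v ∈ F.tangentSpace := by
  rw [F.mem_tangent_iff]
  refine and_congr_right fun _ => ⟨fun h U' ω hω => ?_, fun h V _ ω hω => h V ω hω⟩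
  exact h (X.inter U U') (X.inter_le_left _ _) ω (F.conormal_anti (X.inter_le_right _ _) hω)

theorem exists_mem_tangent (F : Foliation X) {v : X.RationalVectorField}
    (hv : v ∈ F.tangentSpace) : ∃ U, v ∈ F.tangent U := by
  obtain ⟨U, hU⟩ := X.exists_mem_vectorFields v
  exact ⟨U, F.mem_tangent.2 ⟨hU, hv⟩⟩

theorem involutive_tangentSpace (F : Foliation X) : Derivation.Involutive F.tangentSpace := by
  intro v hv w hw
  obtain ⟨U, hU⟩ := X.exists_mem_vectorFields v
  obtain ⟨V, hV⟩ := X.exists_mem_vectorFields w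
  exact (F.mem_tangent.1 (F.involutive (X.inter U V) v
    (F.mem_tangent.2 ⟨X.vectorFields_anti (X.inter_le_left U V) hU, hv⟩) w
    (F.mem_tangent.2 ⟨X.vectorFields_anti (X.inter_le_right U V) hV, hw⟩))).2

theorem containedIn_iff {G F : Foliation X} :
    G.ContainedIn F ↔ G.tangentSpace ≤ F.tangentSpace := by
  refine ⟨fun h v hv => ?_, fun h U v hv => ?_⟩
  · obtain ⟨U, hU⟩ := G.exists_mem_tangent hv
    exact (F.mem_tangent.1 (h U v hU)).2
  · rw [mem_tangent] at hv ⊢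
    exact ⟨hv.1, h hv.2⟩

theorem definedBy_iff {F : Foliation X} {S : Set X.RationalVectorField} :
    F.DefinedBy S ↔ ∀ v, v ∈ F.tangentSpace ↔ v ∈ S := by
  refine ⟨fun h v => ?_, fun h U v => by rw [mem_tangent, h]⟩
  obtain ⟨U, hU⟩ := X.exists_mem_vectorFields v
  have := h U v
  rw [mem_tangent] at this
  simpa [hU] using this

theorem isIntersection_iff {F : Foliation X} {S : Set (Foliation X)} :
    F.IsIntersection S ↔ ∀ v, v ∈ F.tangentSpace ↔ ∀ H ∈ S, v ∈ H.tangentSpace := by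
  refine ⟨fun h v => ?_, fun h U v => ?_⟩
  · obtain ⟨U, hU⟩ := X.exists_mem_vectorFields v
    have := h U v
    simpa [mem_tangent, hU] using this
  · rw [mem_tangent, h]
    refine and_congr_right fun hU => forall₂_congr fun H _ => ?_
    rw [mem_tangent]
    simp [hU]

theorem tangentSpace_injective : Function.Injective (tangentSpace (X := X)) := by
  intro F F' h
  have ht : F.tangent = F'.tangent := by
    funext U
    ext v
    rw [mem_tangent, mem_tangent, h]
  refine Foliation.ext ht ?_
  funext U
  ext ω
  rw [F.mem_conormal_iff, F'.mem_conormal_iff, ht]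

theorem mem_firstIntegrals {F : Foliation X} {f : X.RationalFunction} :
    f ∈ F.firstIntegrals ↔ ∀ v ∈ F.tangentSpace, v f = 0 := by
  refine ⟨fun h v hv => ?_, fun h U v hv => h v (F.mem_tangent.1 hv).2⟩
  obtain ⟨U, hU⟩ := F.exists_mem_tangent hv
  exact h U v hU

/-- First integrals are algebraic over the algebraically closed field ℂ. -/
theorem exists_constant (F : Foliation X) (hF : Algebra.trdeg ℂ F.firstIntegrals = 0)
    (f : X.RationalFunction) (hf : ∀ v ∈ F.tangentSpace, v f = 0) :
    ∃ c : ℂ, algebraMap ℂ X.RationalFunction c = f := by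
  have := trdeg_eq_zero_iff.1 hF
  obtain ⟨c, hc⟩ := IsAlgClosed.algebraMap_bijective_of_isIntegral (k := ℂ)
    (K := F.firstIntegrals) |>.2 ⟨f, mem_firstIntegrals.2 hf⟩
  exact ⟨c, congrArg Subtype.val hc⟩

theorem finrank_tangentSpace_add_codim (F : Foliation X) :
    Module.finrank X.RationalFunction F.tangentSpace + F.codim =
      Module.finrank X.RationalFunction X.RationalVectorField := by
  have h : F.tangentSpace =
      (F.rationalConormal.map X.formEquiv.toLinearMap).dualCoannihilator := by
    ext v
    rw [Submodule.mem_dualCoannihilator]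
    constructor
    · rintro hv _ ⟨ω, hω, rfl⟩
      change X.contract ω v = 0
      rw [SetLike.mem_coe, rationalConormal] at hω
      induction hω using Submodule.span_induction with
      | mem ω h =>
        obtain ⟨U, hU⟩ := Set.mem_iUnion.1 h
        exact hv U ω hU
      | zero => exact X.contract_zero v
      | add a b _ _ ha hb => rw [X.contract_add, ha, hb, add_zero]
      | smul f a _ ha => rw [X.contract_smul, ha, mul_zero]
    · intro h U ω hω
      exact h _ ⟨ω, Submodule.subset_span (Set.mem_iUnion.2 ⟨U, hω⟩), rfl⟩
  have h2 := Subspace.finrank_add_finrank_dualCoannihilator_eq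
    (F.rationalConormal.map X.formEquiv.toLinearMap)
  rw [← h] at h2
  have h3 : Module.finrank X.RationalFunction
      (F.rationalConormal.map X.formEquiv.toLinearMap) = F.codim :=
    LinearEquiv.finrank_map_eq _ _
  omega

/-- The foliation whose rational vector fields are those of an involutive subspace. -/
def ofSubspace (W : Submodule X.RationalFunction X.RationalVectorField)
    (hW : Derivation.Involutive W) : Foliation X where
  tangent U :=
    { carrier := {v | v ∈ X.vectorFields U ∧ v ∈ W}
      add_mem' := fun {v w} hv hw => ⟨fun x hx f hf =>
        Subring.add_mem _ (hv.1 x hx f hf) (hw.1 x hx f hf), W.add_mem hv.2 hw.2⟩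
      zero_mem' := ⟨fun x _ _ _ => Subring.zero_mem _, W.zero_mem⟩
      smul_mem' := fun c v hv => ⟨fun x hx f hf =>
        Subring.mul_mem _ (X.mem_functions.1 c.2 x hx) (hv.1 x hx f hf), W.smul_mem c.1 hv.2⟩ }
  conormal U :=
    { carrier := {ω | ω ∈ X.forms U ∧ ∀ v ∈ W, X.contract ω v = 0}
      add_mem' := fun {a b} ha hb => ⟨fun x hx => Submodule.add_mem _ (ha.1 x hx) (hb.1 x hx),
        fun v hv => by rw [X.contract_add, ha.2 v hv, hb.2 v hv, add_zero]⟩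
      zero_mem' := ⟨fun x _ => Submodule.zero_mem _, fun v _ => X.contract_zero v⟩
      smul_mem' := fun c ω hω => ⟨fun x hx => Submodule.smul_mem _
        (⟨c.1, X.mem_functions.1 c.2 x hx⟩ : X.localRing x) (hω.1 x hx), fun v hv => by
          change X.contract (c.1 • ω) v = 0
          rw [X.contract_smul, hω.2 v hv, mul_zero]⟩ }
  mem_tangent_iff U v := by
    refine and_congr_right fun hv => ⟨fun h V _ ω hω => hω.2 v h, fun h => ?_⟩
    -- A rational form separating v from W is regular on some smaller open set, and so is a conormal
    -- section there.
    by_contra hvW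
    obtain ⟨ω, hωv, hω⟩ := X.exists_contract_ne_zero hvW
    obtain ⟨V, hV⟩ := X.exists_mem_forms ω
    exact hωv (h (X.inter U V) (X.inter_le_left U V) ω
      ⟨X.forms_anti (X.inter_le_right U V) hV, hω⟩)
  mem_conormal_iff U ω := by
    refine and_congr_right fun hω => ⟨fun h V _ v hv => h v hv.2, fun h v hv => ?_⟩
    obtain ⟨V, hV⟩ := X.exists_mem_vectorFields v
    exact h (X.inter U V) (X.inter_le_left U V) v
      ⟨X.vectorFields_anti (X.inter_le_right U V) hV, hv⟩
  involutive U v hv w hw := ⟨X.lie_mem_vectorFields hv.1 hw.1, hW v hv.2 w hw.2⟩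

theorem tangentSpace_ofSubspace (W : Submodule X.RationalFunction X.RationalVectorField)
    (hW : Derivation.Involutive W) : (ofSubspace W hW).tangentSpace = W := by
  ext v
  obtain ⟨U, hU⟩ := X.exists_mem_vectorFields v
  have : v ∈ (ofSubspace W hW).tangent U ↔ v ∈ X.vectorFields U ∧ v ∈ W := Iff.rfl
  rw [mem_tangent] at this
  simpa [hU] using this

theorem exists_functional (F : Foliation X) (hF : F.codim = 1) :
    ∃ ω : Module.Dual X.RationalFunction X.RationalVectorField,
      ∀ v, v ∈ F.tangentSpace ↔ ω v = 0 := by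
  have h := F.finrank_tangentSpace_add_codim
  have h2 := Submodule.finrank_quotient_add_finrank F.tangentSpace
  have h1 : Module.finrank X.RationalFunction (X.RationalVectorField ⧸ F.tangentSpace) =
      Module.finrank X.RationalFunction X.RationalFunction := by
    rw [Module.finrank_self]
    omega
  let e := LinearEquiv.ofFinrankEq _ _ h1
  refine ⟨e.toLinearMap.comp F.tangentSpace.mkQ, fun v => ?_⟩
  simp

end Foliation
end

/-! ### The two correspondences for foliations and the theorem -/

noncomputable section

namespace Foliation

open Derivation

variable {X : ProjectiveManifold}

theorem extDeriv_formEquiv_symm (φ : Module.Dual X.RationalFunction X.RationalVectorField)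
    (v w : X.RationalVectorField) : X.extDeriv (X.formEquiv.symm φ) v w = extD φ v w := by
  rw [ProjectiveManifold.extDeriv, extD_apply]
  simp only [X.contract_formEquiv_symm]

theorem sum_smul_apply {q : ℕ} (ω : Fin q → Module.Dual X.RationalFunction X.RationalVectorField)
    (a : Fin q → ℂ) (x : X.RationalVectorField) : (∑ i, a i • ω i) x = ∑ i, a i • ω i x := by
  rw [LinearMap.sum_apply]
  rfl

section Wedge

variable {G : Foliation X} {q : ℕ}
  {ω : Fin q → Module.Dual X.RationalFunction X.RationalVectorField}
  {v : Fin q → X.RationalVectorField} {η : Module.Dual X.RationalFunction X.RationalVectorField}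

/-- The foliation defined by the combinations `∑ aᵢ ωᵢ` with `a ∈ V`. -/
def ofPlane (hη : ∀ i, ExtDEqWedge η (ω i)) (V : Submodule ℂ (Fin q → ℂ)) : Foliation X :=
  ofSubspace (kernelOf ω V) (involutive_kernelOf hη V)

theorem tangentSpace_ofPlane (hη : ∀ i, ExtDEqWedge η (ω i)) (V : Submodule ℂ (Fin q → ℂ)) :
    (ofPlane hη V).tangentSpace = kernelOf ω V := tangentSpace_ofSubspace _ _

theorem codim_ofPlane (h : TransverseFrame G.tangentSpace ω v)
    (hη : ∀ i, ExtDEqWedge η (ω i)) (V : Submodule ℂ (Fin q → ℂ)) :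
    (ofPlane hη V).codim = Module.finrank ℂ V := by
  have h1 := (ofPlane hη V).finrank_tangentSpace_add_codim
  rw [tangentSpace_ofPlane] at h1
  exact Nat.add_left_cancel (h1.trans (h.finrank_kernelOf V).symm)

theorem containedIn_ofPlane (h : TransverseFrame G.tangentSpace ω v)
    (hη : ∀ i, ExtDEqWedge η (ω i)) (V : Submodule ℂ (Fin q → ℂ)) :
    G.ContainedIn (ofPlane hη V) := by
  rw [containedIn_iff, tangentSpace_ofPlane]
  exact h.le_kernelOf V

theorem ofPlane_injective (h : TransverseFrame G.tangentSpace ω v)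
    (hη : ∀ i, ExtDEqWedge η (ω i)) : Function.Injective (ofPlane hη) := by
  intro V V' he
  have he' := congrArg tangentSpace he
  rw [tangentSpace_ofPlane, tangentSpace_ofPlane] at he'
  ext a
  rw [h.mem_iff_kills_kernelOf, h.mem_iff_kills_kernelOf, he']

theorem exists_ofPlane_eq (h : TransverseFrame G.tangentSpace ω v)
    (hη : ∀ i, ExtDEqWedge η (ω i)) (hG : Algebra.trdeg ℂ G.firstIntegrals = 0)
    {H : Foliation X} (hH : G.ContainedIn H) : ∃ V, ofPlane hη V = H := by
  obtain ⟨V, hV⟩ := h.exists_kernelOf_eq (G.exists_constant hG) hη (containedIn_iff.1 hH)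
    H.involutive_tangentSpace
  exact ⟨V, tangentSpace_injective (by rw [tangentSpace_ofPlane, hV])⟩

theorem identifiedWithGrassmannians (h : TransverseFrame G.tangentSpace ω v)
    (hη : ∀ i, ExtDEqWedge η (ω i)) (hG : Algebra.trdeg ℂ G.firstIntegrals = 0) :
    IdentifiedWithGrassmannians G q := by
  refine ⟨fun i => X.formEquiv.symm (ω i), definedBy_iff.2 fun x => ?_, fun r _ => ?_⟩
  · simp only [X.contract_formEquiv_symm]
    exact h.mem_iff x
  let e : GrassmannianOfPlanes q r → FoliationsContaining G r := fun V =>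
    ⟨ofPlane hη V.1, containedIn_ofPlane h hη V.1, (codim_ofPlane h hη V.1).trans V.2⟩
  have he : Function.Bijective e := by
    refine ⟨fun V V' hV => ?_, fun H => ?_⟩
    · exact Subtype.ext (ofPlane_injective h hη (congrArg Subtype.val hV))
    · obtain ⟨V, hV⟩ := exists_ofPlane_eq h hη hG H.2.1
      exact ⟨⟨V, by rw [← codim_ofPlane h hη V, hV, H.2.2]⟩, Subtype.ext hV⟩
  refine ⟨Equiv.ofBijective e he, fun V => definedBy_iff.2 fun x => ?_⟩
  simp only [X.contract_formEquiv_symm]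
  change x ∈ (ofPlane hη V.1).tangentSpace ↔ _
  rw [tangentSpace_ofPlane]
  rfl

theorem isTransverselyAffine_ofPlane_span (h : TransverseFrame G.tangentSpace ω v)
    (hη : ∀ i, ExtDEqWedge η (ω i)) (hdη : ∀ x y, extD η x y = 0) {a : Fin q → ℂ} (ha : a ≠ 0) :
    (ofPlane hη (Submodule.span ℂ {a})).IsTransverselyAffine := by
  refine ⟨by rw [codim_ofPlane h hη, finrank_span_singleton ha],
    -- The sign turns η ∧ ω into ω ∧ (-η), the order used for transversely affine foliations.
    X.formEquiv.symm (∑ i, a i • ω i), X.formEquiv.symm (-η), definedBy_iff.2 fun x => ?_,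
    fun x y => ?_, fun x y => ?_⟩
  · change _ ↔ X.contract _ x = 0
    rw [tangentSpace_ofPlane, mem_kernelOf, X.contract_formEquiv_symm, sum_smul_apply]
    refine ⟨fun hx => hx a (Submodule.mem_span_singleton_self a), fun hx b hb => ?_⟩
    obtain ⟨c, rfl⟩ := Submodule.mem_span_singleton.1 hb
    simp only [Pi.smul_apply, smul_assoc]
    rw [← Finset.smul_sum, hx, smul_zero]
  · rw [extDeriv_formEquiv_symm]
    have := hdη x y
    rw [extD_apply] at this ⊢
    simp only [LinearMap.neg_apply, map_neg]
    linear_combination -this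
  · rw [extDeriv_formEquiv_symm, ExtDEqWedge.sum_smul hη a]
    simp only [X.contract_formEquiv_symm, LinearMap.neg_apply]
    ring

theorem exists_isIntersection_isTransverselyAffine (h : TransverseFrame G.tangentSpace ω v)
    (hη : ∀ i, ExtDEqWedge η (ω i)) (hdη : ∀ x y, extD η x y = 0)
    (hG : Algebra.trdeg ℂ G.firstIntegrals = 0) {H : Foliation X} (hH : G.ContainedIn H) :
    ∃ S : Set (Foliation X), S.Finite ∧ (∀ A ∈ S, A.IsTransverselyAffine) ∧
      H.IsIntersection S := by
  obtain ⟨V, rfl⟩ := exists_ofPlane_eq h hη hG hH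
  let b := Module.finBasis ℂ V
  refine ⟨Set.range fun j => ofPlane hη (Submodule.span ℂ {(b j : Fin q → ℂ)}),
    Set.finite_range _, ?_, isIntersection_iff.2 fun x => ?_⟩
  · rintro _ ⟨j, rfl⟩
    exact isTransverselyAffine_ofPlane_span h hη hdη
      (fun h0 => b.ne_zero j (Subtype.ext h0))
  · rw [Set.forall_mem_range, tangentSpace_ofPlane, mem_kernelOf]
    simp only [tangentSpace_ofPlane, mem_kernelOf]
    refine ⟨fun hx j a ha => hx a ?_, fun hx a ha => ?_⟩
    · exact (Submodule.span_le.2 (Set.singleton_subset_iff.2 (b j).2)) ha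
    -- For fixed x the condition is ℂ-linear in a, so it suffices to check it on a basis of V.
    · let l : V →ₗ[ℂ] X.RationalFunction :=
        (Fintype.linearCombination ℂ fun i => ω i x).comp V.subtype
      have hl : l = 0 := b.ext fun j => by
        have := hx j (b j) (Submodule.mem_span_singleton_self _)
        simpa [l, Fintype.linearCombination_apply] using this
      have := LinearMap.congr_fun hl ⟨a, ha⟩
      simpa [l, Fintype.linearCombination_apply] using this

end Wedge

section Lie

variable {G : Foliation X} {q : ℕ}
  {ω : Fin q → Module.Dual X.RationalFunction X.RationalVectorField}
  {v : Fin q → X.RationalVectorField} (h : TransverseFrame G.tangentSpace ω v)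
  (hv : ∀ i, v i ∈ liftable G.tangentSpace)
  (hG : Algebra.trdeg ℂ G.firstIntegrals = 0)

/-- The foliation defined by the transverse form modulo a subalgebra. -/
def ofSubalgebra (𝔥 : LieSubalgebra ℂ (TransverseAlgebra G.tangentSpace)) : Foliation X :=
  ofSubspace (h.kernelModulo hv 𝔥)
    (h.involutive_kernelModulo hv (G.exists_constant hG) G.involutive_tangentSpace 𝔥)

theorem tangentSpace_ofSubalgebra (𝔥 : LieSubalgebra ℂ (TransverseAlgebra G.tangentSpace)) :
    (ofSubalgebra h hv hG 𝔥).tangentSpace = h.kernelModulo hv 𝔥 := tangentSpace_ofSubspace _ _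

theorem finrank_add_codim_ofSubalgebra
    (𝔥 : LieSubalgebra ℂ (TransverseAlgebra G.tangentSpace)) :
    Module.finrank ℂ 𝔥 + (ofSubalgebra h hv hG 𝔥).codim =
      Module.finrank ℂ (TransverseAlgebra G.tangentSpace) := by
  have h1 := (ofSubalgebra h hv hG 𝔥).finrank_tangentSpace_add_codim
  rw [tangentSpace_ofSubalgebra] at h1
  have h2 := h.finrank_kernelModulo hv (G.exists_constant hG) G.involutive_tangentSpace 𝔥
  have key : ∀ {a c n d g : ℕ}, a + c = n → a + g = n + d → d + c = g := by omega
  exact key h1 h2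

theorem containedIn_ofSubalgebra (𝔥 : LieSubalgebra ℂ (TransverseAlgebra G.tangentSpace)) :
    G.ContainedIn (ofSubalgebra h hv hG 𝔥) := by
  rw [containedIn_iff, tangentSpace_ofSubalgebra]
  exact h.le_kernelModulo hv (G.exists_constant hG) G.involutive_tangentSpace 𝔥

theorem ofSubalgebra_injective : Function.Injective (ofSubalgebra h hv hG) := by
  intro 𝔥 𝔥' he
  have he' := congrArg tangentSpace he
  rw [tangentSpace_ofSubalgebra, tangentSpace_ofSubalgebra] at he'
  exact h.kernelModulo_injective hv (G.exists_constant hG) G.involutive_tangentSpace he'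

theorem exists_ofSubalgebra_eq {H : Foliation X} (hH : G.ContainedIn H) :
    ∃ 𝔥, ofSubalgebra h hv hG 𝔥 = H := by
  obtain ⟨𝔥, h𝔥⟩ := h.exists_kernelModulo_eq hv (G.exists_constant hG) G.involutive_tangentSpace
    (containedIn_iff.1 hH) H.involutive_tangentSpace
  exact ⟨𝔥, tangentSpace_injective (by rw [tangentSpace_ofSubalgebra, h𝔥])⟩

theorem ofSubalgebra_definedBy (𝔥 : LieSubalgebra ℂ (TransverseAlgebra G.tangentSpace)) :
    (ofSubalgebra h hv hG 𝔥).DefinedBy (kernelMod (X := X) (h.form hv) 𝔥) := by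
  rw [definedBy_iff, tangentSpace_ofSubalgebra]
  exact fun x => h.mem_kernelModulo hv

include hG in
theorem identifiedWithSubalgebras :
    IdentifiedWithSubalgebras (X := X) G q (h.form hv) := by
  intro r _
  let e : SubalgebrasOfCodim (TransverseAlgebra G.tangentSpace) r → FoliationsContaining G r :=
    fun 𝔥 => ⟨ofSubalgebra h hv hG 𝔥.1, containedIn_ofSubalgebra h hv hG 𝔥.1, by
      have h1 := finrank_add_codim_ofSubalgebra h hv hG 𝔥.1
      have h2 := 𝔥.2
      omega⟩
  have he : Function.Bijective e := by
    refine ⟨fun V V' hV => ?_, fun H => ?_⟩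
    · exact Subtype.ext (ofSubalgebra_injective h hv hG (congrArg Subtype.val hV))
    · obtain ⟨𝔥, h𝔥⟩ := exists_ofSubalgebra_eq h hv hG H.2.1
      refine ⟨⟨𝔥, ?_⟩, Subtype.ext h𝔥⟩
      have h1 := finrank_add_codim_ofSubalgebra h hv hG 𝔥
      rwa [h𝔥, H.2.2] at h1
  exact ⟨Equiv.ofBijective e he, fun 𝔥 => ofSubalgebra_definedBy h hv hG 𝔥.1⟩

include hG in
theorem maurerCartan_form : MaurerCartan (X := X) (h.form hv) := fun a b =>
  h.curvature_form hv (G.exists_constant hG) G.involutive_tangentSpace a b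

include hG in
theorem isTransverseLieStructure (hq : G.codim = q) :
    IsTransverseLieStructure G (h.form hv) := by
  have hf := h.finite_transverseAlgebra hv (G.exists_constant hG) G.involutive_tangentSpace
  have hr := h.finrank_transverseAlgebra hv (G.exists_constant hG) G.involutive_tangentSpace
  refine ⟨hf, by rw [hr, hq, Fintype.card_fin], definedBy_iff.2 fun x => ?_,
    maurerCartan_form h hv hG⟩
  exact (h.form_eq_zero_iff hv (G.exists_constant hG) G.involutive_tangentSpace x).symm

include h hv hG in
theorem isTransverselyHomogeneous {H : Foliation X} (hH : G.ContainedIn H) :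
    H.IsTransverselyHomogeneous := by
  obtain ⟨𝔥, rfl⟩ := exists_ofSubalgebra_eq h hv hG hH
  exact ⟨TransverseAlgebra G.tangentSpace, inferInstance, inferInstance, h.form hv, 𝔥,
    h.finite_transverseAlgebra hv (G.exists_constant hG) G.involutive_tangentSpace,
    maurerCartan_form h hv hG, finrank_add_codim_ofSubalgebra h hv hG 𝔥,
    ofSubalgebra_definedBy h hv hG 𝔥⟩

end Lie

end Foliation

open Derivation Foliation in
theorem theoremC (X : ProjectiveManifold) (q : ℕ) (hq : 2 ≤ q) (G : Foliation X)
    (hcodim : G.codim = q)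
    (htrdeg : Algebra.trdeg ℂ G.firstIntegrals = 0)
    (F : Fin (q + 1) → Foliation X)
    (hF : ∀ i, (F i).codim = 1 ∧ G.ContainedIn (F i))
    (hinter : ∀ j, G.IsIntersection {H | ∃ i, i ≠ j ∧ H = F i}) :
    (IdentifiedWithGrassmannians G q ∧
      ∀ H : Foliation X, G.ContainedIn H →
        ∃ S : Set (Foliation X), S.Finite ∧ (∀ A ∈ S, A.IsTransverselyAffine) ∧
          H.IsIntersection S) ∨
    (∃ (𝔤 : Type) (_ : LieRing 𝔤) (_ : LieAlgebra ℂ 𝔤) (Ω : LieValuedForm X 𝔤),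
      Module.finrank ℂ 𝔤 = q ∧ ¬ IsLieAbelian 𝔤 ∧
      IsTransverseLieStructure G Ω ∧
      IdentifiedWithSubalgebras G q Ω ∧
      ∀ H : Foliation X, G.ContainedIn H → H.IsTransverselyHomogeneous) := by
  choose φ hφ using fun i => (F i).exists_functional (hF i).1
  have hT : ∀ j x, x ∈ G.tangentSpace ↔ ∀ i, i ≠ j → φ i x = 0 := by
    intro j x
    rw [isIntersection_iff.1 (hinter j) x]
    refine ⟨fun h i hij => (hφ i x).1 (h _ ⟨i, hij, rfl⟩), ?_⟩
    rintro h _ ⟨i, hij, rfl⟩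
    exact (hφ i x).2 (h i hij)
  have hrank := G.finrank_tangentSpace_add_codim
  rw [hcodim] at hrank
  have hinv : ∀ i, ∀ a b, φ i a = 0 → φ i b = 0 → φ i ⁅a, b⁆ = 0 := by
    intro i a b ha hb
    rw [← hφ] at ha hb ⊢
    exact (F i).involutive_tangentSpace a ha b hb
  have : CharZero X.RationalFunction := charZero_of_injective_algebraMap (algebraMap ℂ _).injective
  obtain ⟨ω, v, h, ⟨η, hdη, hη⟩ | hv⟩ := exists_wedge_or_liftable hq hT hrank hinv
  · exact Or.inl ⟨identifiedWithGrassmannians h hη htrdeg,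
      fun H hH => exists_isIntersection_isTransverselyAffine h hη hdη htrdeg hH⟩
  -- An abelian transverse algebra belongs to the first alternative, with η = 0.
  by_cases hab : IsLieAbelian (TransverseAlgebra G.tangentSpace)
  · have hη := h.extDEqWedge_zero_of_isLieAbelian hv G.involutive_tangentSpace hab
    have hd0 : ∀ x y : X.RationalVectorField,
        extD (0 : Module.Dual X.RationalFunction X.RationalVectorField) x y = 0 := by
      intro x y
      simp [extD_apply]
    exact Or.inl ⟨identifiedWithGrassmannians h hη htrdeg,
      fun H hH => exists_isIntersection_isTransverselyAffine h hη hd0 htrdeg hH⟩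
  · refine Or.inr ⟨TransverseAlgebra G.tangentSpace, inferInstance, inferInstance, h.form hv,
      ?_, hab, isTransverseLieStructure h hv htrdeg hcodim,
      identifiedWithSubalgebras h hv htrdeg,
      fun H hH => isTransverselyHomogeneous h hv htrdeg hH⟩
    rw [h.finrank_transverseAlgebra hv (G.exists_constant htrdeg) G.involutive_tangentSpace,
      Fintype.card_fin]

end
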